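/- Let $0<a<1$, $0<b<1$. The wind-tree table $T(a,b)$ is the plane $\mathbb{R}^2$ deprived of the open rectangles of width $a$ (horizontally) and height $b$ (vertically) centered at the points of $\mathbb{Z}^2$. A point moves in $T(a,b)$ at unit speed along straight lines and is reflected elastically at the sides of the rectangles; its trajectory ends if it meets a corner of a rectangle. The angles taken by a trajectory of initial angle $\theta$ lie in $\{\theta,-\theta,\pi-\theta,\pi+\theta\}$; a trajectory in direction $\theta$ is one whose angles lie in this set. It is called self-avoiding if the moving point is never at the same place at two different times. The flow in direction $\theta$ is called divergent if for Lebesgue-almost every $x\in T(a,b)$ the trajectory $t\mapsto\phi_t^\theta(x)$ that starts at $x$ with angle $\theta$ is defined for all $t\ge 0$ and $\liminf_{t\to\infty} d(x,\phi^\theta_t(x))=+\infty$, where $d$ is the Euclidean distance. For a quadruple $Z=(x_1,x_2,y_1,y_2)$ of positive real numbers put $$m(Z)=\left\lfloor\frac{x_1}{y_1+y_2}\right\rfloor,\qquad n(Z)=\left\lfloor\frac{x_2}{y_1}\right\rfloor,\qquad F(Z)=\bigl(y_1,\;y_2,\;x_1-m(Z)(y_1+y_2),\;x_2-n(Z)\,y_1\bigr).$$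 Call $Z$ $F$-renormalizable if for every $k\ge 0$ the iterate $F^k(Z)$ is defined, is a quadruple of positive numbers, and does not satisfy $$x_1+x_2>y_1>x_2\quad\text{and}\quad y_1+y_2>x_1>y_2 .$$ The $F$-convergents of an $F$-renormalizable $Z$ are the pairs $(m_k,n_k)=(m(F^k(Z)),n(F^k(Z)))$, $k\ge0$. Theorem. Let $(a,b,\theta)\in(0,1)^2\times[0,\pi/2)$ and $$Z=\bigl((1-b)\cos\theta,\;b\cos\theta,\;(1-a)\sin\theta,\;a\sin\theta\bigr).$$ Assume that $Z$ is $F$-renormalizable and that $n_k$ is even for every $k\ge0$, where $((m_k,n_k))_{k\ge0}$ are the $F$-convergents of $Z$. Then every infinite forward billiard trajectory in direction $\theta$ in $T(a,b)$ is self-avoiding, and the flow in direction $\theta$ in $T(a,b)$ is divergent. -/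

import Mathlib

namespace WindTree

/-! ### The continued fraction algorithm `F` on quadruples -/

/-- A quadruple `Z = (x₁, x₂, y₁, y₂)` of real numbers. -/
@[ext]
structure Quad where
  x₁ : ℝ
  x₂ : ℝ
  y₁ : ℝ
  y₂ : ℝ

/-- All four entries are positive: the domain of `F`. -/
def Quad.Pos (Z : Quad) : Prop :=
  0 < Z.x₁ ∧ 0 < Z.x₂ ∧ 0 < Z.y₁ ∧ 0 < Z.y₂

/-- `m(Z) = ⌊x₁ / (y₁ + y₂)⌋`. -/
noncomputable def Quad.m (Z : Quad) : ℤ := ⌊Z.x₁ / (Z.y₁ + Z.y₂)⌋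

/-- `n(Z) = ⌊x₂ / y₁⌋`. -/
noncomputable def Quad.n (Z : Quad) : ℤ := ⌊Z.x₂ / Z.y₁⌋

/-- `F(Z) = (y₁, y₂, x₁ - m(Z) (y₁ + y₂), x₂ - n(Z) y₁)`. -/
noncomputable def F (Z : Quad) : Quad where
  x₁ := Z.y₁
  x₂ := Z.y₂
  y₁ := Z.x₁ - Z.m * (Z.y₁ + Z.y₂)
  y₂ := Z.x₂ - Z.n * Z.y₁

/-- The condition under which the algorithm is blocked: it implies `m(Z) = n(Z) = 0` and
`F (F Z) = Z`. -/
def Quad.Blocked (Z : Quad) : Prop :=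
  (Z.x₁ + Z.x₂ > Z.y₁ ∧ Z.y₁ > Z.x₂) ∧ (Z.y₁ + Z.y₂ > Z.x₁ ∧ Z.x₁ > Z.y₂)

/-- `Z` is `F`-renormalizable: all iterates `F^k(Z)` are defined (`F` acts on quadruples of
positive numbers) and none of them is blocked. -/
def FRenormalizable (Z : Quad) : Prop :=
  ∀ k : ℕ, (F^[k] Z).Pos ∧ ¬ (F^[k] Z).Blocked

/-- The first entry `m_k` of the `k`-th `F`-convergent of `Z`. -/
noncomputable def convM (Z : Quad) (k : ℕ) : ℤ := (F^[k] Z).m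

/-- The second entry `n_k` of the `k`-th `F`-convergent of `Z`. -/
noncomputable def convN (Z : Quad) (k : ℕ) : ℤ := (F^[k] Z).n

/-- The quadruple attached to the parameters `(a, b, θ)`. -/
noncomputable def quadOf (a b θ : ℝ) : Quad where
  x₁ := (1 - b) * Real.cos θ
  x₂ := b * Real.cos θ
  y₁ := (1 - a) * Real.sin θ
  y₂ := a * Real.sin θ

/-! ### The billiard table -/

/-- The Euclidean plane. -/
abbrev Plane := EuclideanSpace ℝ (Fin 2)

/-- The table `T(a, b)`: the plane deprived of the (open) rectangles of width `a` and height `b`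
centered at the points of `ℤ²`. -/
def table (a b : ℝ) : Set Plane :=
  {p | ∀ i j : ℤ, ¬ (|p 0 - i| < a / 2 ∧ |p 1 - j| < b / 2)}

/-- The (open) vertical sides of the scatterers. -/
def verticalSides (a b : ℝ) : Set Plane :=
  {p | ∃ i j : ℤ, |p 0 - i| = a / 2 ∧ |p 1 - j| < b / 2}

/-- The (open) horizontal sides of the scatterers. -/
def horizontalSides (a b : ℝ) : Set Plane :=
  {p | ∃ i j : ℤ, |p 0 - i| < a / 2 ∧ |p 1 - j| = b / 2}

/-- The corners of the scatterers. -/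
def corners (a b : ℝ) : Set Plane :=
  {p | ∃ i j : ℤ, |p 0 - i| = a / 2 ∧ |p 1 - j| = b / 2}

/-! ### Billiard trajectories -/

/-- The Klein four group, acting on directions by changing the signs of the two coordinates. -/
abbrev K := ℤˣ × ℤˣ

/-- The reflection of a direction at a vertical side. -/
def τv : K := (-1, 1)

/-- The reflection of a direction at a horizontal side. -/
def τh : K := (1, -1)

/-- The unit vector of angle `κ(θ)`. -/
noncomputable def dir (θ : ℝ) (κ : K) : Plane :=
  !₂[((κ.1 : ℤ) : ℝ) * Real.cos θ, ((κ.2 : ℤ) : ℝ) * Real.sin θ]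

open Classical in
/-- The change of direction undergone at the point `p` of the table (not a corner). -/
noncomputable def reflection (a b : ℝ) (p : Plane) : K :=
  if p ∈ verticalSides a b then τv
  else if p ∈ horizontalSides a b then τh
  else 1

/-- `γ t = (x_t, κ_t)`, `t ≥ 0`, is an infinite forward trajectory of the billiard flow in
direction `θ` in `T(a, b)`: the point stays in the table and never meets a corner, it moves at
unit speed along straight lines in direction `κ_t(θ)`, and its direction just before time `t`
differs from the one at (and just after) time `t` by the reflection at the side to which `x_t`
belongs, if there is one. The values of `γ` at negative times are irrelevant. -/
structure IsForwardTrajectory (a b θ : ℝ) (γ : ℝ → Plane × K) : Prop where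
  mem_table : ∀ t, 0 ≤ t → (γ t).1 ∈ table a b
  not_corner : ∀ t, 0 ≤ t → (γ t).1 ∉ corners a b
  after : ∀ t, 0 ≤ t → ∃ ε > 0, ∀ s, t ≤ s → s < t + ε →
    γ s = ((γ t).1 + (s - t) • dir θ (γ t).2, (γ t).2)
  before : ∀ t, 0 < t → ∃ ε > 0, ∀ s, 0 ≤ s → t - ε < s → s < t →
    γ s = ((γ t).1 - (t - s) • dir θ (reflection a b (γ t).1 * (γ t).2),
      reflection a b (γ t).1 * (γ t).2)

/-- A trajectory is self-avoiding if the moving point never visits the same place twice. -/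
def SelfAvoiding (γ : ℝ → Plane × K) : Prop :=
  Set.InjOn (fun t => (γ t).1) (Set.Ici 0)

/-- The billiard flow in direction `θ` in `T(a, b)` is divergent: for almost every point `x` of
the table, the trajectory which starts at `x` with angle `θ` is defined for all positive times and
`liminf_{t → ∞} d(x, φ_t(x)) = +∞`. -/
def DivergentFlow (a b θ : ℝ) : Prop :=
  ∀ᵐ x ∂(MeasureTheory.volume.restrict (table a b)),
    (∃ γ, IsForwardTrajectory a b θ γ ∧ γ 0 = (x, 1)) ∧
    ∀ γ, IsForwardTrajectory a b θ γ → γ 0 = (x, 1) →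
      Filter.liminf (fun t : ℝ => edist x (γ t).1) Filter.atTop = ⊤

end WindTree

namespace WindTree

/-! ### Words, frames and boxes -/

/-! Unfold the billiard at every reflection. In coordinates `(U, V)` relative to a moving `Frame`,
the point always travels up and to the right in an L-shaped cell, made of a crossing of two
corridors and the two passages leaving it. The transverse coordinate `U sin θ - V cos θ` is constant
along a flight and changes between flights by an exchange of four intervals, whose lengths are the
entries of `Z`. A letter records how a flight ends. A trajectory thus becomes an infinite word
acting on lattice frames: `h₁`, `v₁` by translations, `h₂`, `v₂` by glide reflections.

It remains to see that passages and crossings do not recur. Each letter sweeps a lattice `Box`, and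
`Sep` asks that the boxes of the first and last letters of a word be disjoint. This is proved for
all parameters satisfying `Params.Ok` at once, because renormalization changes the parameters. If
only one kind of reflection occurs, one coordinate is monotone and separation is direct
(`sep_of_h₂_notMem`, `sep_of_v₂_notMem`). Otherwise pass to the first return map on a subinterval,
which is the exchange of the twisted quadruple: the word is a piece of the image under `sub m n` of
a word of the twisted exchange (`cover_of_valid`). In the block `h₂ⁿ v₁ h₁ᵐ` the reflections cancel
because `n` is even, so the block acts as one translation (`actList_sub`) and its boxes fit in one
box for twisted parameters (`boxesIn_sub`). Separation therefore descends from the covering word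
(`sep_of_cover`).

Exchanging the two axes turns the twisted quadruple into `F Z`, and the argument repeats. Since no
iterate is blocked, the twist is nontrivial as soon as the quadruple is reduced; two successive
steps then either shorten the word or reach one with a single kind of reflection
(`Renorm.sep_of_reduced`).

Disjoint boxes give self-avoidance (`Regular.point_ne`) and finitely many visits to each crossing
(`IsOrbit.finite_visits`), hence escape to infinity for every infinite trajectory. Infinite
trajectories exist off countably many lines (`ae_exists_trajectory`). -/

/-- The four letters which code the crossings of a trajectory: `h₁` and `v₁` are the passages to the
next crossing of corridors, `h₂` and `v₂` the reflections at vertical and horizontal sides. -/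
inductive Letter
  | h₁ | h₂ | v₁ | v₂

open Letter

/-- The exchange of the two coordinate directions, on letters. -/
def Letter.swap : Letter → Letter
  | h₁ => v₁ | h₂ => v₂ | v₁ => h₁ | v₂ => h₂

@[simp] lemma Letter.swap_swap (l : Letter) : l.swap.swap = l := by cases l <;> rfl

/-- A position in the lattice together with a pair of signs giving a direction. -/
@[ext]
structure Frame where
  x : ℤ
  y : ℤ
  ε : ℤˣ
  δ : ℤˣ

/-- The exchange of the two coordinate directions, on frames. -/
def Frame.swap (g : Frame) : Frame := ⟨g.y, g.x, g.δ, g.ε⟩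

@[simp] lemma Frame.swap_swap (g : Frame) : g.swap.swap = g := rfl

/-- The parameters of an action of the letters on frames by translations and glide reflections. -/
structure Params where
  p₁ : ℤ
  p₂ : ℤ
  q₁ : ℤ
  q₂ : ℤ
  ρ : ℤ
  σ : ℤ

/-- The exchange of the two coordinate directions, on parameters. -/
def Params.swap (π : Params) : Params := ⟨π.q₂, π.q₁, π.p₂, π.p₁, π.σ, π.ρ⟩

/-- The inequalities between the parameters which make the boxes below separated. -/
structure Params.Ok (π : Params) : Prop where
  ρ_nonneg : 0 ≤ π.ρ
  ρ_lt : π.ρ < π.p₁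
  σ_nonneg : 0 ≤ π.σ
  σ_lt : π.σ < π.q₂
  p₂_nonneg : 0 ≤ π.p₂
  q₁_nonneg : 0 ≤ π.q₁

lemma Params.Ok.swap {π : Params} (h : π.Ok) : π.swap.Ok :=
  ⟨h.σ_nonneg, h.σ_lt, h.ρ_nonneg, h.ρ_lt, h.q₁_nonneg, h.p₂_nonneg⟩

/-- The action of a letter on frames. -/
def act (π : Params) : Letter → Frame → Frame
  | h₁, g => ⟨g.x + g.ε * π.p₁, g.y + g.δ * π.p₂, g.ε, g.δ⟩
  | v₁, g => ⟨g.x + g.ε * π.q₁, g.y + g.δ * π.q₂, g.ε, g.δ⟩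
  | h₂, g => ⟨g.x - g.ε * π.ρ, g.y + g.δ * π.p₂, -g.ε, g.δ⟩
  | v₂, g => ⟨g.x + g.ε * π.q₁, g.y - g.δ * π.σ, g.ε, -g.δ⟩

/-- The action of a word on frames. -/
def actList (π : Params) : List Letter → Frame → Frame
  | [], g => g
  | l :: w, g => actList π w (act π l g)

@[simp] lemma actList_nil (π : Params) (g : Frame) : actList π [] g = g := rfl

@[simp] lemma actList_cons (π : Params) (l : Letter) (w : List Letter) (g : Frame) :
    actList π (l :: w) g = actList π w (act π l g) := rfl

@[simp] lemma actList_append (π : Params) (w w' : List Letter) (g : Frame) :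
    actList π (w ++ w') g = actList π w' (actList π w g) := by
  induction w generalizing g with
  | nil => rfl
  | cons l w ih => simp [ih]

lemma act_swap (π : Params) (l : Letter) (g : Frame) :
    act π.swap l.swap g.swap = (act π l g).swap := by
  cases l <;> rfl

lemma actList_swap (π : Params) (w : List Letter) (g : Frame) :
    actList π.swap (w.map Letter.swap) g.swap = (actList π w g).swap := by
  induction w generalizing g with
  | nil => rfl
  | cons l w ih => simp [act_swap, ih]

lemma act_surjective (π : Params) (l : Letter) : Function.Surjective (act π l) := by
  intro g
  cases l
  · exact ⟨⟨g.x - g.ε * π.p₁, g.y - g.δ * π.p₂, g.ε, g.δ⟩, by simp [act]⟩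
  · exact ⟨⟨g.x - g.ε * π.ρ, g.y - g.δ * π.p₂, -g.ε, g.δ⟩, by simp [act]⟩
  · exact ⟨⟨g.x - g.ε * π.q₁, g.y - g.δ * π.q₂, g.ε, g.δ⟩, by simp [act]⟩
  · exact ⟨⟨g.x - g.ε * π.q₁, g.y - g.δ * π.σ, g.ε, -g.δ⟩, by simp [act]⟩

lemma actList_surjective (π : Params) (w : List Letter) : Function.Surjective (actList π w) := by
  induction w with
  | nil => exact fun g => ⟨g, rfl⟩
  | cons l w ih =>
    intro g
    obtain ⟨g₁, h₁⟩ := ih g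
    obtain ⟨g₂, h₂⟩ := act_surjective π l g₁
    exact ⟨g₂, by simp [h₁, h₂]⟩

/-- The box attached to a letter: the point `(u, v)` lies in the box of `l` based at the
frame `g`. -/
def Box (π : Params) (l : Letter) (g : Frame) (u v : ℤ) : Prop :=
  match l with
  | h₁ => (1 ≤ g.ε * (u - g.x) ∧ g.ε * (u - g.x) ≤ π.p₁) ∧
      (-π.σ ≤ g.δ * (v - g.y) ∧ g.δ * (v - g.y) ≤ π.p₂)
  | v₁ => (-π.ρ ≤ g.ε * (u - g.x) ∧ g.ε * (u - g.x) ≤ π.q₁) ∧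
      (1 ≤ g.δ * (v - g.y) ∧ g.δ * (v - g.y) ≤ π.q₂)
  | h₂ => (-π.ρ ≤ g.ε * (u - g.x) ∧ g.ε * (u - g.x) ≤ 0) ∧
      (1 ≤ g.δ * (v - g.y) ∧ g.δ * (v - g.y) ≤ π.p₂)
  | v₂ => (1 ≤ g.ε * (u - g.x) ∧ g.ε * (u - g.x) ≤ π.q₁) ∧
      (-π.σ ≤ g.δ * (v - g.y) ∧ g.δ * (v - g.y) ≤ 0)

lemma box_swap (π : Params) (l : Letter) (g : Frame) (u v : ℤ) :
    Box π.swap l.swap g.swap v u ↔ Box π l g u v := by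
  cases l <;> exact and_comm

/-- The boxes of the first and the last letter of a word are disjoint. -/
def Sep (π : Params) (w : List Letter) : Prop :=
  ∀ l₀ mid l g u v, w = l₀ :: (mid ++ [l]) → Box π l₀ g u v →
    ¬ Box π l (actList π (l₀ :: mid) g) u v

lemma Sep.swap {π : Params} {w : List Letter} (h : Sep π w) :
    Sep π.swap (w.map Letter.swap) := by
  intro l₀ mid l g u v hw h₀ h₁
  have hw' : w = l₀.swap :: (mid.map Letter.swap ++ [l.swap]) := by
    have := congrArg (List.map Letter.swap) hw
    simpa [Function.comp_def] using this
  refine h l₀.swap (mid.map Letter.swap) l.swap g.swap v u hw' ?_ ?_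
  · rw [← box_swap]; simpa using h₀
  · have := actList_swap π (l₀.swap :: mid.map Letter.swap) g.swap
    rw [← box_swap, ← this]
    simpa [Function.comp_def] using h₁

lemma sep_swap_iff {π : Params} {w : List Letter} :
    Sep π.swap (w.map Letter.swap) ↔ Sep π w := by
  refine ⟨fun h => ?_, Sep.swap⟩
  have := h.swap
  simpa [Function.comp_def, Params.swap] using this

/-- The constraints on consecutive letters: after a reflection, a trajectory is reflected again at
the opposite side of the same corridor or leaves this corridor. -/
def Adj (l l' : Letter) : Prop :=
  (l = v₂ → l' = v₂ ∨ l' = h₁) ∧ (l = h₂ → l' = h₂ ∨ l' = v₁)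

lemma Adj.swap {l l' : Letter} (h : Adj l l') : Adj l.swap l'.swap := by
  cases l <;> cases l' <;> simp_all [Adj, Letter.swap]

lemma isChain_swap {w : List Letter} (h : w.IsChain Adj) : (w.map Letter.swap).IsChain Adj := by
  rw [List.isChain_map]
  exact h.imp fun _ _ => Adj.swap

/-! ### Words with one kind of reflection: monotone progress -/

/-- The way in which the point `(u, v)` lies behind the frame `g` reached after the letter
`prev`. -/
def Behind (π : Params) (prev : Letter) (g : Frame) (u v : ℤ) : Prop :=
  (prev ≠ v₂ ∧ g.ε * u ≤ g.ε * g.x ∧ g.δ * v ≤ g.δ * g.y) ∨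
    (prev = v₂ ∧ g.ε * u ≤ g.ε * g.x) ∨ g.ε * u + π.p₁ ≤ g.ε * g.x

lemma Box.behind {π : Params} (hπ : π.Ok) {l : Letter} (hl : l ≠ h₂) {g : Frame} {u v : ℤ}
    (h : Box π l g u v) : Behind π l (act π l g) u v := by
  obtain ⟨x, y, ε, δ⟩ := g
  obtain ⟨h1, h2, h3, h4, h5, h6⟩ := hπ
  rcases Int.units_eq_one_or ε with rfl | rfl <;> rcases Int.units_eq_one_or δ with rfl | rfl <;>
    cases l <;> simp_all [Box, Behind, act] <;> omega

/-- Without `h₂`, a box needs a step of at least 1 forward in one coordinate. After `v₂` only the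
first coordinate is controlled, but then `Adj` leaves `v₂` and `h₁`, whose boxes start at offset 1
in that coordinate. A lag of `p₁ > ρ` keeps the point out even of the backward part of the box of
`v₁`. -/
lemma Behind.not_box {π : Params} (hπ : π.Ok) {prev l : Letter} (hl : l ≠ h₂)
    (hadj : Adj prev l) {g : Frame} {u v : ℤ} (h : Behind π prev g u v) : ¬ Box π l g u v := by
  obtain ⟨x, y, ε, δ⟩ := g
  obtain ⟨h1, h2, h3, h4, h5, h6⟩ := hπ
  rcases Int.units_eq_one_or ε with rfl | rfl <;> rcases Int.units_eq_one_or δ with rfl | rfl <;>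
    cases l <;> simp_all [Box, Behind, Adj] <;> grind

lemma Behind.act {π : Params} (hπ : π.Ok) {prev l : Letter} (hl : l ≠ h₂)
    (hadj : Adj prev l) {g : Frame} {u v : ℤ} (h : Behind π prev g u v) :
    Behind π l (act π l g) u v := by
  obtain ⟨x, y, ε, δ⟩ := g
  obtain ⟨h1, h2, h3, h4, h5, h6⟩ := hπ
  rcases Int.units_eq_one_or ε with rfl | rfl <;> rcases Int.units_eq_one_or δ with rfl | rfl <;>
    cases l <;> simp_all [Behind, WindTree.act, Adj] <;> grind

lemma Behind.not_box_actList {π : Params} (hπ : π.Ok) {u v : ℤ} (l : Letter)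
    (mid : List Letter) : ∀ (prev : Letter) (g : Frame),
      (prev :: (mid ++ [l])).IsChain Adj → h₂ ∉ mid ++ [l] → Behind π prev g u v →
      ¬ Box π l (actList π mid g) u v := by
  induction mid with
  | nil =>
    intro prev g hc hn hb
    simp at hc hn
    exact hb.not_box hπ (fun h => hn h.symm) hc
  | cons k mid ih =>
    intro prev g hc hn hb
    simp only [List.cons_append, List.isChain_cons_cons] at hc
    simp only [List.cons_append, List.mem_cons, not_or] at hn
    exact ih k _ hc.2 hn.2 (hb.act hπ (fun h => hn.1 h.symm) hc.1)

/-- The sign `ε` changes only under `h₂`, so here the first coordinate advances monotonically and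
`Behind` is an invariant of the whole walk. -/
lemma sep_of_h₂_notMem {π : Params} (hπ : π.Ok) {w : List Letter} (hc : w.IsChain Adj)
    (hn : h₂ ∉ w) : Sep π w := by
  rintro l₀ mid l g u v rfl h₀
  simp only [List.mem_cons, not_or] at hn
  exact Behind.not_box_actList hπ l mid l₀ _ hc hn.2 (h₀.behind hπ (fun h => hn.1 h.symm))

lemma sep_of_v₂_notMem {π : Params} (hπ : π.Ok) {w : List Letter} (hc : w.IsChain Adj)
    (hn : v₂ ∉ w) : Sep π w := by
  rw [← sep_swap_iff]
  refine sep_of_h₂_notMem hπ.swap (isChain_swap hc) ?_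
  rw [List.mem_map]
  rintro ⟨l, hl, h⟩
  cases l <;> simp_all [Letter.swap]

/-- The letter `l` occurs in the word `w`, neither only at the beginning nor at the end. -/
def Inside (l : Letter) (w : List Letter) : Prop :=
  ∃ l₀ mid l₁, w = l₀ :: (mid ++ [l₁]) ∧ l ∈ mid

lemma Inside.swap {l : Letter} {w : List Letter} (h : Inside l w) :
    Inside l.swap (w.map Letter.swap) := by
  obtain ⟨l₀, mid, l₁, rfl, hl⟩ := h
  exact ⟨l₀.swap, mid.map Letter.swap, l₁.swap, by simp, List.mem_map_of_mem hl⟩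

/-- After `h₂` only `h₂` or `v₁` is allowed, so a run of `h₂` can be left only through `v₁`. -/
lemma mem_of_isChain_h₂_v₂ (β : List Letter) (γ : List Letter) :
    (h₂ :: (β ++ v₂ :: γ)).IsChain Adj → v₁ ∈ β := by
  induction β with
  | nil => intro h; simp [Adj] at h
  | cons k β ih =>
    intro h
    simp only [List.cons_append, List.isChain_cons_cons] at h
    rcases h.1.2 rfl with rfl | rfl
    · exact List.mem_cons_of_mem _ (ih h.2)
    · simp

lemma inside_of_append {l a b : Letter} {α β γ : List Letter} (h : l ∈ β) :
    Inside l (α ++ a :: (β ++ b :: γ)) := by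
  have h1 : ∃ l₀ α', α ++ a :: (β ++ b :: γ) = l₀ :: (α' ++ β ++ b :: γ) := by
    cases α with
    | nil => exact ⟨a, [], by simp⟩
    | cons c α => exact ⟨c, α ++ [a], by simp⟩
  have h2 : ∃ γ' l₁, b :: γ = γ' ++ [l₁] := by
    rcases List.eq_nil_or_concat (b :: γ) with h | ⟨γ', l₁, h⟩
    · simp at h
    · exact ⟨γ', l₁, by simpa using h⟩
  obtain ⟨l₀, α', h1⟩ := h1
  obtain ⟨γ', l₁, h2⟩ := h2
  exact ⟨l₀, α' ++ β ++ γ', l₁, by rw [h1, h2]; simp, by simp [h]⟩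

/-- A word with both kinds of reflections contains a passage between two of them. -/
lemma inside_of_mem {w : List Letter} (hc : w.IsChain Adj) (h2 : h₂ ∈ w) (h2' : v₂ ∈ w) :
    Inside v₁ w ∨ Inside h₁ w := by
  obtain ⟨α, β, rfl⟩ := List.append_of_mem h2
  rw [List.mem_append, List.mem_cons] at h2'
  rcases h2' with h | h | h
  · right
    obtain ⟨α₁, α₂, rfl⟩ := List.append_of_mem h
    have hc' := isChain_swap (hc.suffix (l₁ := v₂ :: (α₂ ++ h₂ :: β)) (by simp))
    have := mem_of_isChain_h₂_v₂ (α₂.map Letter.swap) (β.map Letter.swap)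
      (by simpa [Letter.swap] using hc')
    have : h₁ ∈ α₂ := by
      obtain ⟨k, hk, hk'⟩ := List.mem_map.1 this
      cases k <;> simp_all [Letter.swap]
    simpa using inside_of_append (α := α₁) (a := v₂) (b := h₂) (γ := β) this
  · cases h
  · left
    obtain ⟨β₁, β₂, rfl⟩ := List.append_of_mem h
    exact inside_of_append (mem_of_isChain_h₂_v₂ _ β₂ (hc.suffix (by simp)))

/-! ### The interval exchange of a quadruple and its renormalization -/

/-- The exchange of the two coordinate directions, on quadruples. -/
def Quad.swap (Z : Quad) : Quad := ⟨Z.y₁, Z.y₂, Z.x₁, Z.x₂⟩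

lemma Quad.Pos.swap {Z : Quad} (h : Z.Pos) : Z.swap.Pos := ⟨h.2.2.1, h.2.2.2, h.1, h.2.1⟩

/-- The translation of the interval exchange on the interval of a letter. -/
def shift (Z : Quad) : Letter → ℝ
  | h₁ => -(Z.y₁ + Z.y₂)
  | h₂ => -Z.y₁
  | v₁ => Z.x₁ + Z.x₂
  | v₂ => Z.x₁

/-- The interval of a letter. -/
def dom (Z : Quad) : Letter → Set ℝ
  | v₁ => Set.Ioo (-Z.x₁ - Z.x₂) (Z.y₁ - Z.x₁ - Z.x₂)
  | h₂ => Set.Ioo (Z.y₁ - Z.x₁ - Z.x₂) (Z.y₁ - Z.x₁)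
  | v₂ => Set.Ioo (Z.y₁ - Z.x₁) (Z.y₁ + Z.y₂ - Z.x₁)
  | h₁ => Set.Ioo (Z.y₁ + Z.y₂ - Z.x₁) (Z.y₁ + Z.y₂)

/-- The total translation along a word. -/
def shiftSum (Z : Quad) : List Letter → ℝ
  | [] => 0
  | l :: w => shift Z l + shiftSum Z w

@[simp] lemma shiftSum_nil (Z : Quad) : shiftSum Z [] = 0 := rfl

@[simp] lemma shiftSum_cons (Z : Quad) (l : Letter) (w : List Letter) :
    shiftSum Z (l :: w) = shift Z l + shiftSum Z w := rfl

@[simp] lemma shiftSum_append (Z : Quad) (w w' : List Letter) :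
    shiftSum Z (w ++ w') = shiftSum Z w + shiftSum Z w' := by
  induction w with
  | nil => simp
  | cons l w ih => simp [ih, add_assoc]

@[simp] lemma shiftSum_replicate (Z : Quad) (l : Letter) (k : ℕ) :
    shiftSum Z (List.replicate k l) = k * shift Z l := by
  induction k with
  | zero => simp
  | succ k ih => simp [List.replicate_succ, ih]; ring

/-- The word `w` codes the beginning of the orbit of `f` under the interval exchange. -/
def Valid (Z : Quad) : ℝ → List Letter → Prop
  | _, [] => True
  | f, l :: w => f ∈ dom Z l ∧ Valid Z (f + shift Z l) w

@[simp] lemma valid_nil (Z : Quad) (f : ℝ) : Valid Z f [] := trivial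

@[simp] lemma valid_cons (Z : Quad) (f : ℝ) (l : Letter) (w : List Letter) :
    Valid Z f (l :: w) ↔ f ∈ dom Z l ∧ Valid Z (f + shift Z l) w := Iff.rfl

lemma valid_append (Z : Quad) (f : ℝ) (w w' : List Letter) :
    Valid Z f (w ++ w') ↔ Valid Z f w ∧ Valid Z (f + shiftSum Z w) w' := by
  induction w generalizing f with
  | nil => simp
  | cons l w ih => simp [ih, and_assoc, add_assoc]

lemma dom_unique {Z : Quad} (hZ : Z.Pos) {f : ℝ} {l k : Letter} (hl : f ∈ dom Z l)
    (hk : f ∈ dom Z k) : l = k := by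
  obtain ⟨h1, h2, h3, h4⟩ := hZ
  cases l <;> cases k <;> simp only [dom, Set.mem_Ioo] at hl hk <;>
    first | rfl | (exfalso; linarith [hl.1, hl.2, hk.1, hk.2])

/-- The interval of `v₂` is carried to `(y₁, y₁ + y₂)`, to the right of the intervals of `v₁` and
`h₂`; that of `h₂` is carried to `(-x₁ - x₂, -x₁)`, to the left of those of `v₂` and `h₁`. -/
lemma Valid.isChain {Z : Quad} (hZ : Z.Pos) {w : List Letter} :
    ∀ {f : ℝ}, Valid Z f w → w.IsChain Adj := by
  induction w with
  | nil => simp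
  | cons l w ih =>
    intro f h
    cases w with
    | nil => simp
    | cons k w =>
      refine List.isChain_cons_cons.2 ⟨?_, ih h.2⟩
      obtain ⟨h1, h2, h3, h4⟩ := hZ
      have hl := h.1
      have hk := h.2.1
      cases l <;> cases k <;> simp only [dom, shift, Set.mem_Ioo, Adj] at hl hk ⊢ <;>
        first | (simp; done) | (exfalso; linarith [hl.1, hl.2, hk.1, hk.2])

/-- Exchanging the axes reverses the transverse coordinate, whence the sign. -/
lemma valid_swap {Z : Quad} {w : List Letter} {f : ℝ} (h : Valid Z f w) :
    Valid Z.swap (-f) (w.map Letter.swap) := by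
  induction w generalizing f with
  | nil => simp
  | cons l w ih =>
    refine ⟨?_, ?_⟩
    · have hl := h.1
      cases l <;> simp only [dom, Quad.swap, Letter.swap, Set.mem_Ioo] at hl ⊢ <;>
        constructor <;> linarith [hl.1, hl.2]
    · convert ih h.2 using 1
      cases l <;> simp only [shift, Quad.swap, Letter.swap] <;> ring

/-- `f` is not an integral combination of the entries of `Z`. -/
def Generic (Z : Quad) (f : ℝ) : Prop :=
  ∀ i j k l : ℤ, f ≠ i * Z.x₁ + j * Z.x₂ + k * Z.y₁ + l * Z.y₂

lemma Generic.swap {Z : Quad} {f : ℝ} (h : Generic Z f) : Generic Z.swap (-f) := by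
  intro i j k l e
  refine h (-k) (-l) (-i) (-j) ?_
  simp only [Quad.swap] at e
  push_cast
  linarith

lemma generic_shift {Z : Quad} {f : ℝ} (h : Generic Z f) (l : Letter) :
    Generic Z (f + shift Z l) := by
  intro i j k n e
  cases l <;> simp only [shift] at e
  · exact h i j (k + 1) (n + 1) (by push_cast; linarith)
  · exact h i j (k + 1) n (by push_cast; linarith)
  · exact h (i - 1) (j - 1) k n (by push_cast; linarith)
  · exact h (i - 1) j k n (by push_cast; linarith)

lemma generic_shiftSum {Z : Quad} {w : List Letter} :
    ∀ {f : ℝ}, Generic Z f → Generic Z (f + shiftSum Z w) := by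
  induction w with
  | nil => simp
  | cons l w ih =>
    intro f h
    have := ih (generic_shift h l)
    simpa [add_assoc] using this

lemma exists_dom {Z : Quad} {f : ℝ} (hf : Generic Z f) (h1 : -Z.x₁ - Z.x₂ < f)
    (h2 : f < Z.y₁ + Z.y₂) : ∃ l, f ∈ dom Z l := by
  have e1 := hf (-1) (-1) 1 0
  have e2 := hf (-1) 0 1 0
  have e3 := hf (-1) 0 1 1
  push_cast at e1 e2 e3
  rcases lt_or_gt_of_ne e1 with h | h
  · exact ⟨v₁, by constructor <;> linarith⟩
  rcases lt_or_gt_of_ne e2 with h' | h'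
  · exact ⟨h₂, by constructor <;> linarith⟩
  rcases lt_or_gt_of_ne e3 with h'' | h''
  · exact ⟨v₂, by constructor <;> linarith⟩
  · exact ⟨h₁, by constructor <;> linarith⟩

lemma dom_subset {Z : Quad} (hZ : Z.Pos) {f : ℝ} {l : Letter} (h : f ∈ dom Z l) :
    -Z.x₁ - Z.x₂ < f ∧ f < Z.y₁ + Z.y₂ := by
  obtain ⟨h1, h2, h3, h4⟩ := hZ
  cases l <;> simp only [dom, Set.mem_Ioo] at h <;> constructor <;> linarith [h.1, h.2]

lemma shift_mem {Z : Quad} (hZ : Z.Pos) {f : ℝ} {l : Letter} (h : f ∈ dom Z l) :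
    -Z.x₁ - Z.x₂ < f + shift Z l ∧ f + shift Z l < Z.y₁ + Z.y₂ := by
  obtain ⟨h1, h2, h3, h4⟩ := hZ
  cases l <;> simp only [dom, shift, Set.mem_Ioo] at h ⊢ <;> constructor <;> linarith [h.1, h.2]

lemma shiftSum_mem {Z : Quad} (hZ : Z.Pos) {w : List Letter} (hw : w ≠ []) :
    ∀ {f : ℝ}, Valid Z f w →
      -Z.x₁ - Z.x₂ < f + shiftSum Z w ∧ f + shiftSum Z w < Z.y₁ + Z.y₂ := by
  induction w with
  | nil => simp at hw
  | cons l w ih =>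
    intro f h
    by_cases hnil : w = []
    · subst hnil
      simpa using shift_mem hZ h.1
    · simpa [add_assoc] using ih hnil h.2

/-! ### The twisted exchange as a first return map -/

/-- Twisting the two horizontal cylinders. -/
def Quad.twist (Z : Quad) (m n : ℕ) : Quad :=
  ⟨Z.x₁ - m * (Z.y₁ + Z.y₂), Z.x₂ - n * Z.y₁, Z.y₁, Z.y₂⟩

/-- The substitution which recovers the coding from the coding after twisting. -/
def sub (m n : ℕ) : Letter → List Letter
  | h₁ => [h₁]
  | h₂ => [h₂]
  | v₁ => List.replicate n h₂ ++ v₁ :: List.replicate m h₁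
  | v₂ => v₂ :: List.replicate m h₁

lemma sub_ne_nil (m n : ℕ) (l : Letter) : sub m n l ≠ [] := by cases l <;> simp [sub]

lemma shiftSum_sub (Z : Quad) (m n : ℕ) (l : Letter) :
    shiftSum Z (sub m n l) = shift (Z.twist m n) l := by
  cases l <;> simp [sub, shift, Quad.twist] <;> ring

lemma valid_replicate_h₁ {Z : Quad} (hZ : Z.Pos) (k : ℕ) {f : ℝ} (h1 : f < Z.y₁ + Z.y₂)
    (h2 : k * (Z.y₁ + Z.y₂) - Z.x₁ < f) : Valid Z f (List.replicate k h₁) := by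
  obtain ⟨_, _, h3, h4⟩ := hZ
  induction k generalizing f with
  | zero => simp
  | succ k ih =>
    push_cast at h2
    have : 0 ≤ (k : ℝ) * (Z.y₁ + Z.y₂) := by positivity
    refine ⟨⟨by linarith, h1⟩, ih ?_ ?_⟩ <;> simp only [shift] <;> linarith

lemma valid_replicate_h₂ {Z : Quad} (hZ : Z.Pos) (k : ℕ) {f : ℝ} (h1 : f < Z.y₁ - Z.x₁)
    (h2 : k * Z.y₁ - Z.x₁ - Z.x₂ < f) : Valid Z f (List.replicate k h₂) := by
  obtain ⟨_, _, h3, h4⟩ := hZ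
  induction k generalizing f with
  | zero => simp
  | succ k ih =>
    push_cast at h2
    have : 0 ≤ (k : ℝ) * Z.y₁ := by positivity
    refine ⟨⟨by linarith, h1⟩, ih ?_ ?_⟩ <;> simp only [shift] <;> linarith

/-- The twisted exchange is the first return map to `(-x₁ - x₂ + n y₁, (1 - m)(y₁ + y₂))`.
Translation by `m (y₁ + y₂)` identifies this subinterval with the twisted domain, which explains the
offset here and in the lemmas below. -/
lemma valid_sub {Z : Quad} (hZ : Z.Pos) {m n : ℕ} (hT : (Z.twist m n).Pos) {l : Letter} {f : ℝ}
    (h : f ∈ dom (Z.twist m n) l) : Valid Z (f - m * (Z.y₁ + Z.y₂)) (sub m n l) := by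
  obtain ⟨t1, t2, t3, t4⟩ := hT
  have hZ' := hZ
  obtain ⟨z1, z2, z3, z4⟩ := hZ'
  have hn : 0 ≤ n * Z.y₁ := by positivity
  simp only [Quad.twist] at t1 t2
  cases l <;> simp only [dom, Quad.twist, Set.mem_Ioo] at h
  · have hm : 0 ≤ m * (Z.y₁ + Z.y₂) := by positivity
    simp only [sub, valid_cons, dom, Set.mem_Ioo, valid_nil, and_true]
    constructor <;> linarith [h.1, h.2]
  · simp only [sub, valid_cons, dom, Set.mem_Ioo, valid_nil, and_true]
    constructor <;> linarith [h.1, h.2]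
  · simp only [sub, valid_append, valid_cons, shiftSum_replicate, shift]
    refine ⟨valid_replicate_h₂ hZ _ ?_ ?_, ⟨?_, ?_⟩, valid_replicate_h₁ hZ _ ?_ ?_⟩ <;>
      linarith [h.1, h.2]
  · simp only [sub, valid_cons, shift]
    refine ⟨⟨?_, ?_⟩, valid_replicate_h₁ hZ _ ?_ ?_⟩ <;> linarith [h.1, h.2]

lemma shiftSum_flatMap (Z : Quad) (m n : ℕ) (w : List Letter) :
    shiftSum Z (w.flatMap (sub m n)) = shiftSum (Z.twist m n) w := by
  induction w with
  | nil => simp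
  | cons l w ih => simp [shiftSum_sub, ih]

lemma valid_flatMap {Z : Quad} (hZ : Z.Pos) {m n : ℕ} (hT : (Z.twist m n).Pos)
    {w : List Letter} : ∀ {f : ℝ}, Valid (Z.twist m n) f w →
      Valid Z (f - m * (Z.y₁ + Z.y₂)) (w.flatMap (sub m n)) := by
  induction w with
  | nil => simp
  | cons l w ih =>
    intro f h
    rw [List.flatMap_cons, valid_append, shiftSum_sub]
    refine ⟨valid_sub hZ hT h.1, ?_⟩
    convert ih h.2 using 1
    ring

lemma generic_untwist {Z : Quad} {m n : ℕ} {f : ℝ} (h : Generic Z (f - m * (Z.y₁ + Z.y₂))) :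
    Generic (Z.twist m n) f := by
  intro i j k l e
  refine h i j (k - i * m - j * n - m) (l - i * m - m) ?_
  rw [e]
  simp only [Quad.twist]
  push_cast
  ring

/-- Every point of the interval lies in the tower of some letter of the twisted exchange. -/
lemma exists_tower {Z : Quad} (hZ : Z.Pos) {m n : ℕ} (hT : (Z.twist m n).Pos) {f : ℝ}
    (hf : Generic Z f) (hf1 : -Z.x₁ - Z.x₂ < f) (hf2 : f < Z.y₁ + Z.y₂) :
    ∃ f' a u v, f' ∈ dom (Z.twist m n) a ∧ sub m n a = u ++ v ∧ v ≠ [] ∧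
      f = f' - m * (Z.y₁ + Z.y₂) + shiftSum Z u := by
  have hT' := hT
  obtain ⟨t1, t2, t3, t4⟩ := hT'
  have hZ' := hZ
  obtain ⟨z1, z2, z3, z4⟩ := hZ'
  simp only [Quad.twist] at t1 t2
  have ys : 0 < Z.y₁ + Z.y₂ := by linarith
  rcases lt_or_ge f ((1 - m) * (Z.y₁ + Z.y₂)) with hJ | hJ
  · rcases lt_or_ge (-Z.x₁ - Z.x₂ + n * Z.y₁) f with hJ' | hJ'
    · have : Generic (Z.twist m n) (f + m * (Z.y₁ + Z.y₂)) :=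
        generic_untwist (by simpa using hf)
      obtain ⟨a, ha⟩ := exists_dom this (by simp only [Quad.twist]; linarith)
        (by simp only [Quad.twist]; linarith)
      exact ⟨_, a, [], sub m n a, ha, rfl, sub_ne_nil m n a, by simp⟩
    -- Left of the return interval the orbit is in the initial run of `h₂` of a `v₁` tower; `k + 1`
    -- steps back by `y₁` reach the base.
    · set e := (-Z.x₁ - Z.x₂ + n * Z.y₁ - f) / Z.y₁ with he
      have he' : e * Z.y₁ = -Z.x₁ - Z.x₂ + n * Z.y₁ - f := by rw [he]; field_simp
      have e0 : 0 ≤ e := div_nonneg (by linarith) z3.le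
      have en : e < n := by
        rw [he, div_lt_iff₀ z3]; linarith
      have k1 := Nat.floor_le e0
      have k2 := Nat.lt_floor_add_one e
      set k := ⌊e⌋₊
      have kn : k < n := by exact_mod_cast k1.trans_lt en
      obtain ⟨r, hr⟩ := Nat.exists_eq_add_of_lt kn
      refine ⟨f + (k + 1) * Z.y₁ + m * (Z.y₁ + Z.y₂), v₁, List.replicate (k + 1) h₂,
        List.replicate r h₂ ++ v₁ :: List.replicate m h₁, ?_, ?_, by simp, ?_⟩
      · have a1 : e * Z.y₁ < (k + 1) * Z.y₁ := by gcongr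
        have a2 : k * Z.y₁ ≤ e * Z.y₁ := by gcongr
        have a3 : f + (k + 1) * Z.y₁ ≠ -Z.x₁ - Z.x₂ + (n + 1) * Z.y₁ := by
          have := hf (-1) (-1) (n - k) 0
          push_cast at this
          intro h; apply this; linarith
        have a4 : f + (k + 1) * Z.y₁ < -Z.x₁ - Z.x₂ + (n + 1) * Z.y₁ :=
          lt_of_le_of_ne (by linarith) a3
        simp only [dom, Quad.twist, Set.mem_Ioo]
        constructor <;> linarith
      · simp only [sub, ← List.append_assoc, List.replicate_append_replicate]
        congr 2
        omega
      · simp [shift]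
  -- Right of the return interval the orbit is in a final run of `h₁`. Undoing `k` of these steps
  -- puts it in `(0, y₁ + y₂)`, the union up to an endpoint of the images of `v₁` and `v₂`;
  -- comparison with `y₁` tells which tower it is.
  · set e := -f / (Z.y₁ + Z.y₂) with he
    have he' : e * (Z.y₁ + Z.y₂) = -f := by rw [he]; field_simp
    have e0 : -1 < e := by rw [he, lt_div_iff₀ ys]; linarith
    have en : e ≤ m - 1 := by rw [he, div_le_iff₀ ys]; linarith
    have k1 := Int.le_ceil e
    have k2 := Int.ceil_lt_add_one e
    have k0 : 0 ≤ ⌈e⌉ := by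
      have : (-1 : ℝ) < ⌈e⌉ := e0.trans_le k1
      have : (-1 : ℤ) < ⌈e⌉ := by exact_mod_cast this
      omega
    have km : ⌈e⌉ < m := by
      have : (⌈e⌉ : ℝ) < m := by linarith
      exact_mod_cast this
    obtain ⟨k, hk⟩ := Int.eq_ofNat_of_zero_le k0
    rw [hk] at k1 k2 km
    push_cast at k1 k2
    have km' : k < m := by exact_mod_cast km
    obtain ⟨r, hr⟩ := Nat.exists_eq_add_of_lt km'
    have a1 : e * (Z.y₁ + Z.y₂) ≤ k * (Z.y₁ + Z.y₂) := by gcongr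
    have a2 : k * (Z.y₁ + Z.y₂) < (e + 1) * (Z.y₁ + Z.y₂) := by gcongr
    have a3 : f + k * (Z.y₁ + Z.y₂) ≠ 0 := by
      have := hf 0 0 (-k) (-k)
      push_cast at this
      intro h; apply this; linarith
    have a4 : 0 < f + k * (Z.y₁ + Z.y₂) := lt_of_le_of_ne (by linarith) a3.symm
    have a5 : f + k * (Z.y₁ + Z.y₂) ≠ Z.y₁ := by
      have := hf 0 0 (1 - k) (-k)
      push_cast at this
      intro h; apply this; linarith
    have hm : List.replicate m h₁ = List.replicate k h₁ ++ List.replicate (r + 1) h₁ := by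
      rw [List.replicate_append_replicate]; congr 1
    rcases lt_or_gt_of_ne a5 with h | h
    · refine ⟨f + k * (Z.y₁ + Z.y₂) - (Z.x₁ - m * (Z.y₁ + Z.y₂)) - (Z.x₂ - n * Z.y₁), v₁,
        List.replicate n h₂ ++ v₁ :: List.replicate k h₁, List.replicate (r + 1) h₁,
        ?_, ?_, by simp, ?_⟩
      · simp only [dom, Quad.twist, Set.mem_Ioo]
        constructor <;> linarith
      · simp [sub, hm]
      · simp [shift]; ring
    · refine ⟨f + k * (Z.y₁ + Z.y₂) - (Z.x₁ - m * (Z.y₁ + Z.y₂)), v₂,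
        v₂ :: List.replicate k h₁, List.replicate (r + 1) h₁, ?_, ?_, by simp, ?_⟩
      · simp only [dom, Quad.twist, Set.mem_Ioo]
        constructor <;> linarith
      · simp [sub, hm]
      · simp [shift]; ring

/-- The word `w` is covered by the image of a word of the twisted exchange, whose first letter is
`a`; the covering word is either `a` or `a :: (mid ++ [z])`. -/
def Cover (Z : Quad) (m n : ℕ) (f : ℝ) (w : List Letter) : Prop :=
  ∃ f' a u a₂, sub m n a = u ++ a₂ ∧ f = f' - m * (Z.y₁ + Z.y₂) + shiftSum Z u ∧
    ((∃ v, a₂ = w ++ v ∧ f' ∈ dom (Z.twist m n) a) ∨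
      ∃ mid z z₁ v, Valid (Z.twist m n) f' (a :: (mid ++ [z])) ∧ sub m n z = z₁ ++ v ∧
        z₁ ≠ [] ∧ a₂ ≠ [] ∧ w = a₂ ++ mid.flatMap (sub m n) ++ z₁)

lemma exists_next_letter {Z : Quad} (hZ : Z.Pos) {m n : ℕ} (hT : (Z.twist m n).Pos) {f' : ℝ}
    {w' : List Letter} (hw' : w' ≠ []) (hv : Valid (Z.twist m n) f' w') {l : Letter}
    (hg : Generic Z (f' + shiftSum (Z.twist m n) w' - m * (Z.y₁ + Z.y₂)))
    (hl : f' + shiftSum (Z.twist m n) w' - m * (Z.y₁ + Z.y₂) ∈ dom Z l) :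
    ∃ z v, Valid (Z.twist m n) f' (w' ++ [z]) ∧ sub m n z = [l] ++ v := by
  have h1 := shiftSum_mem hT hw' hv
  obtain ⟨z, hz⟩ := exists_dom (generic_untwist hg (n := n)) h1.1 h1.2
  have h2 := valid_sub hZ hT hz
  rcases h : sub m n z with _ | ⟨k, v⟩
  · exact absurd h (sub_ne_nil m n z)
  rw [h] at h2
  obtain rfl := dom_unique hZ hl h2.1
  exact ⟨z, v, (valid_append _ _ _ _).2 ⟨hv, hz, trivial⟩, h⟩

/-- Induction by appending a letter: either the current tower still has a letter to offer, and it is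
the right one since the intervals are disjoint, or the orbit has returned to the base and a new
tower begins. -/
lemma cover_of_valid {Z : Quad} (hZ : Z.Pos) {m n : ℕ} (hT : (Z.twist m n).Pos) {f : ℝ}
    (hf : Generic Z f) {w : List Letter} (hw : w ≠ []) (hv : Valid Z f w) : Cover Z m n f w := by
  induction w using List.reverseRecOn with
  | nil => exact absurd rfl hw
  | append_singleton w l ih =>
    rw [valid_append] at hv
    obtain ⟨hv, hl, -⟩ := hv
    by_cases hw0 : w = []
    · subst hw0
      simp only [shiftSum_nil, add_zero] at hl
      obtain ⟨f', a, u, v, h1, h2, h3, h4⟩ :=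
        exists_tower hZ hT hf (dom_subset hZ hl).1 (dom_subset hZ hl).2
      have h5 := valid_sub hZ hT h1
      rw [h2, valid_append, ← h4] at h5
      rcases v with _ | ⟨k, v⟩
      · exact absurd rfl h3
      obtain rfl := dom_unique hZ hl h5.2.1
      exact ⟨f', a, u, _, h2, h4, Or.inl ⟨v, rfl, h1⟩⟩
    · obtain ⟨f', a, u, a₂, h2, h4, h⟩ := ih hw0 hv
      refine ⟨f', a, u, a₂, h2, h4, ?_⟩
      have hgen := generic_shiftSum (w := w) hf
      rcases h with ⟨v, rfl, h1⟩ | ⟨mid, z, z₁, v, h1, h3, h5, h6, rfl⟩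
      · rcases v with _ | ⟨k, v⟩
        · right
          have e : f' + shiftSum (Z.twist m n) [a] - m * (Z.y₁ + Z.y₂) = f + shiftSum Z w := by
            simp only [shiftSum_cons, shiftSum_nil, ← shiftSum_sub, h2, shiftSum_append]
            linarith
          obtain ⟨z, v, hz, hz'⟩ := exists_next_letter hZ hT (w' := [a]) (by simp) ⟨h1, trivial⟩
            (by rwa [e]) (by rwa [e])
          exact ⟨[], z, [l], v, hz, hz', by simp, by simpa using hw0, by simp⟩
        · left
          have h5 := valid_sub hZ hT h1
          rw [h2, valid_append, ← h4, valid_append] at h5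
          obtain rfl := dom_unique hZ hl h5.2.2.1
          exact ⟨v, by simp, h1⟩
      · right
        rcases v with _ | ⟨k, v⟩
        · simp only [List.append_nil] at h3
          have e : f' + shiftSum (Z.twist m n) (a :: (mid ++ [z])) - m * (Z.y₁ + Z.y₂) =
              f + shiftSum Z (a₂ ++ mid.flatMap (sub m n) ++ z₁) := by
            simp only [shiftSum_cons, shiftSum_nil, ← shiftSum_sub, ← shiftSum_flatMap, h2, h3,
              shiftSum_append]
            linarith
          obtain ⟨z', v, hz, hz'⟩ := exists_next_letter hZ hT (by simp) h1
            (by rwa [e]) (by rwa [e])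
          exact ⟨mid ++ [z], z', [l], v, by simpa using hz, hz', by simp, h6, by simp [h3]⟩
        · have h7 := valid_flatMap hZ hT h1
          simp only [List.flatMap_cons, List.flatMap_append, List.flatMap_nil, h2, h3,
            valid_append, List.append_nil, valid_cons] at h7
          have e : f' - m * (Z.y₁ + Z.y₂) + shiftSum Z (u ++ a₂) +
              shiftSum Z (mid.flatMap (sub m n)) + shiftSum Z z₁ =
              f + shiftSum Z (a₂ ++ mid.flatMap (sub m n) ++ z₁) := by
            simp only [shiftSum_append]; linarith
          rw [e] at h7
          obtain rfl := dom_unique hZ hl h7.2.2.2.1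
          exact ⟨mid, z, z₁ ++ [l], v, h1, by simp [h3], by simp, h6, by simp⟩

/-! ### Separation of the boxes along words -/

/-- Twisting the parameters. -/
def Params.twist (π : Params) (m n : ℕ) : Params :=
  ⟨π.p₁, π.p₂, π.q₁ + m * π.p₁, π.q₂ + (n + m) * π.p₂, π.ρ, π.σ + m * π.p₂⟩

lemma Params.Ok.twist {π : Params} (h : π.Ok) (m n : ℕ) : (π.twist m n).Ok := by
  obtain ⟨h1, h2, h3, h4, h5, h6⟩ := h
  have a1 : 0 ≤ m * π.p₂ := by positivity
  have a2 : 0 ≤ n * π.p₂ := by positivity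
  have a3 : 0 ≤ m * π.p₁ := mul_nonneg (by positivity) (by omega)
  constructor <;> simp only [Params.twist, add_mul] <;> omega

lemma actList_replicate_h₁ (π : Params) (k : ℕ) (g : Frame) :
    actList π (List.replicate k h₁) g =
      ⟨g.x + g.ε * (k * π.p₁), g.y + g.δ * (k * π.p₂), g.ε, g.δ⟩ := by
  induction k generalizing g with
  | zero => simp
  | succ k ih =>
    rw [List.replicate_succ, actList_cons, ih]
    ext <;> simp [act] <;> ring

lemma actList_replicate_h₂ (π : Params) (k : ℕ) (g : Frame) :
    actList π (List.replicate k h₂) g =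
      ⟨g.x - (if Even k then 0 else g.ε * π.ρ), g.y + g.δ * (k * π.p₂),
        if Even k then g.ε else -g.ε, g.δ⟩ := by
  induction k generalizing g with
  | zero => simp
  | succ k ih =>
    rw [List.replicate_succ, actList_cons, ih]
    by_cases h : Even k <;> ext <;> simp [act, h, Nat.even_add_one] <;> ring

/-- Evenness enters here: an even power of the glide reflection `h₂` is a translation, so the block
of `v₁` keeps both signs. -/
lemma actList_sub (π : Params) (m : ℕ) {n : ℕ} (hn : Even n) (l : Letter) (g : Frame) :
    actList π (sub m n l) g = act (π.twist m n) l g := by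
  cases l <;> simp only [sub, actList_append, actList_cons, actList_nil, actList_replicate_h₁,
    actList_replicate_h₂, hn, if_true, act, Params.twist] <;> ext <;> simp <;> ring

/-- All the boxes along the word `w` starting at `g` are contained in the set `P`. -/
def BoxesIn (π : Params) (P : ℤ → ℤ → Prop) : List Letter → Frame → Prop
  | [], _ => True
  | l :: w, g => (∀ u v, Box π l g u v → P u v) ∧ BoxesIn π P w (act π l g)

lemma boxesIn_append {π : Params} {P : ℤ → ℤ → Prop} {w w' : List Letter} {g : Frame} :
    BoxesIn π P (w ++ w') g ↔ BoxesIn π P w g ∧ BoxesIn π P w' (actList π w g) := by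
  induction w generalizing g with
  | nil => simp [BoxesIn]
  | cons l w ih => simp [BoxesIn, ih, and_assoc]

lemma boxesIn_replicate {π : Params} {P : ℤ → ℤ → Prop} {l : Letter} {k : ℕ} {g : Frame}
    (h : ∀ i < k, ∀ u v, Box π l (actList π (List.replicate i l) g) u v → P u v) :
    BoxesIn π P (List.replicate k l) g := by
  induction k with
  | zero => trivial
  | succ k ih =>
    rw [List.replicate_succ', boxesIn_append]
    exact ⟨ih fun i hi => h i (by omega), h k (by omega), trivial⟩

/-- The twisted parameters are chosen so that one box contains every small box swept by the block.
The backward margin `σ` grows by `m p₂` without spoiling `σ < q₂`, since `q₂` grows at least as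
much. -/
lemma boxesIn_sub {π : Params} (hπ : π.Ok) (m : ℕ) {n : ℕ} (hn : Even n) (l : Letter)
    (g : Frame) : BoxesIn π (Box (π.twist m n) l g) (sub m n l) g := by
  obtain ⟨h1, h2, h3, h4, h5, h6⟩ := hπ
  have a1 : 0 ≤ m * π.p₂ := by positivity
  have a2 : 0 ≤ n * π.p₂ := by positivity
  have a3 : 0 ≤ m * π.p₁ := mul_nonneg (by positivity) (by omega)
  have key : ∀ k i : ℕ, i < k → ∀ p : ℤ, 0 ≤ p → 0 ≤ i * p ∧ i * p + p ≤ k * p := by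
    intro k i hi p hp
    refine ⟨by positivity, ?_⟩
    have : ((i : ℤ) + 1) * p ≤ k * p := mul_le_mul_of_nonneg_right (by exact_mod_cast hi) hp
    linarith
  obtain ⟨x, y, ε, δ⟩ := g
  cases l
  · refine ⟨fun u v h => ?_, trivial⟩
    simp only [Box, Params.twist] at h ⊢
    omega
  · exact ⟨fun u v h => h, trivial⟩
  · rw [sub, boxesIn_append]
    refine ⟨boxesIn_replicate fun i hi u v h => ?_, fun u v h => ?_,
      boxesIn_replicate fun i hi u v h => ?_⟩
    · have k1 := key n i hi _ h5
      by_cases he : Even i <;>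
      rcases Int.units_eq_one_or ε with rfl | rfl <;>
      rcases Int.units_eq_one_or δ with rfl | rfl <;>
      simp [actList_replicate_h₂, Box, Params.twist, add_mul, he] at h ⊢ <;> omega
    · rcases Int.units_eq_one_or ε with rfl | rfl <;>
      rcases Int.units_eq_one_or δ with rfl | rfl <;>
      simp [actList_replicate_h₂, Box, Params.twist, add_mul, hn] at h ⊢ <;> omega
    · have k1 := key m i hi _ h5
      have k2 := key m i hi π.p₁ (by omega)
      rcases Int.units_eq_one_or ε with rfl | rfl <;>
      rcases Int.units_eq_one_or δ with rfl | rfl <;>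
      simp [actList_replicate_h₂, actList_replicate_h₁, act, Box, Params.twist, add_mul, hn]
        at h ⊢ <;> omega
  · refine ⟨fun u v h => ?_, boxesIn_replicate fun i hi u v h => ?_⟩
    · simp only [Box, Params.twist] at h ⊢
      omega
    · have k1 := key m i hi _ h5
      have k2 := key m i hi π.p₁ (by omega)
      rcases Int.units_eq_one_or ε with rfl | rfl <;>
      rcases Int.units_eq_one_or δ with rfl | rfl <;>
      simp [actList_replicate_h₁, act, Box, Params.twist] at h ⊢ <;> omega

lemma actList_flatMap (π : Params) (m : ℕ) {n : ℕ} (hn : Even n) (w : List Letter) (g : Frame) :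
    actList π (w.flatMap (sub m n)) g = actList (π.twist m n) w g := by
  induction w generalizing g with
  | nil => rfl
  | cons l w ih => simp [actList_sub π m hn, ih]

/-- The end letters of the long word lie in the blocks of `a` and `z`, so their boxes lie in the two
boxes that the covering word separates. The frame is first moved back along `u` to the start of the
block of `a`. -/
lemma sep_of_cover {π : Params} (hπ : π.Ok) {m n : ℕ} (hn : Even n) {a z : Letter}
    {mid u a₂ z₁ v : List Letter} (ha : sub m n a = u ++ a₂) (hz : sub m n z = z₁ ++ v)
    (ha₂ : a₂ ≠ []) (hz₁ : z₁ ≠ []) (h : Sep (π.twist m n) (a :: (mid ++ [z]))) :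
    Sep π (a₂ ++ mid.flatMap (sub m n) ++ z₁) := by
  intro l₀ mid' l g c d hw h₀ h₁
  obtain ⟨k, a₃, rfl⟩ := List.exists_cons_of_ne_nil ha₂
  obtain ⟨z₃, k', rfl⟩ : ∃ z₃ k', z₁ = z₃ ++ [k'] := by
    rcases List.eq_nil_or_concat z₁ with h | ⟨z₃, k', h⟩
    · exact absurd h hz₁
    · exact ⟨z₃, k', by simpa using h⟩
  have hw' : k :: ((a₃ ++ mid.flatMap (sub m n) ++ z₃) ++ [k']) = l₀ :: (mid' ++ [l]) := by
    simpa using hw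
  obtain ⟨rfl, hw₁⟩ := List.cons.inj hw'
  obtain ⟨rfl, hw₂⟩ := List.append_inj' hw₁ rfl
  obtain rfl : k' = l := by simpa using hw₂
  obtain ⟨g₀, rfl⟩ := actList_surjective π u g
  refine h a mid z g₀ c d rfl ?_ ?_
  · have := boxesIn_sub hπ m hn a g₀
    rw [ha, boxesIn_append] at this
    exact this.2.1 _ _ h₀
  · have := boxesIn_sub hπ m hn z (actList (π.twist m n) (a :: mid) g₀)
    rw [hz, List.append_assoc, boxesIn_append] at this
    refine this.2.1 _ _ ?_
    rw [actList_cons, ← actList_sub π m hn, ← actList_flatMap π m hn, ha]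
    simpa using h₁

/-- This excludes a word with both kinds of reflections from being part of a single block. -/
lemma not_mem_sub (m n : ℕ) (l : Letter) : ¬ (h₂ ∈ sub m n l ∧ v₂ ∈ sub m n l) := by
  cases l <;> simp [sub, List.mem_replicate]

lemma length_le_length_flatMap (m n : ℕ) (w : List Letter) :
    w.length ≤ (w.flatMap (sub m n)).length := by
  induction w with
  | nil => simp
  | cons l w ih =>
    have := List.length_pos_of_ne_nil (sub_ne_nil m n l)
    simp only [List.length_cons, List.flatMap_cons, List.length_append]
    omega

lemma length_lt_length_flatMap {m n : ℕ} (hmn : m ≠ 0 ∨ n ≠ 0) {w : List Letter} (h : v₁ ∈ w) :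
    w.length < (w.flatMap (sub m n)).length := by
  obtain ⟨α, β, rfl⟩ := List.append_of_mem h
  have h1 := length_le_length_flatMap m n α
  have h2 := length_le_length_flatMap m n β
  simp only [List.flatMap_append, List.flatMap_cons, List.length_append, List.length_cons, sub,
    List.length_replicate]
  omega

lemma v₁_mem_of_mem_flatMap {m n : ℕ} {w : List Letter} (h : v₁ ∈ w.flatMap (sub m n)) :
    v₁ ∈ w := by
  obtain ⟨l, hl, h⟩ := List.mem_flatMap.1 h
  cases l <;> simp_all [sub, List.mem_replicate]

/-! ### Induction on the length of words along the algorithm -/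

/-- `Z` is renormalizable and its second convergents are even. -/
structure Renorm (Z : Quad) : Prop where
  ren : FRenormalizable Z
  even : ∀ k, Even (convN Z k)

lemma Renorm.next {Z : Quad} (h : Renorm Z) : Renorm (F Z) :=
  ⟨fun k => h.ren (k + 1), fun k => h.even (k + 1)⟩

lemma Renorm.pos {Z : Quad} (h : Renorm Z) : Z.Pos := (h.ren 0).1

lemma Renorm.m_nonneg {Z : Quad} (h : Renorm Z) : 0 ≤ Z.m := by
  obtain ⟨h1, h2, h3, h4⟩ := h.pos
  exact Int.floor_nonneg.2 (by positivity)

lemma Renorm.n_nonneg {Z : Quad} (h : Renorm Z) : 0 ≤ Z.n := by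
  obtain ⟨h1, h2, h3, h4⟩ := h.pos
  exact Int.floor_nonneg.2 (by positivity)

lemma Renorm.F_eq {Z : Quad} (h : Renorm Z) :
    F Z = (Z.twist Z.m.toNat Z.n.toNat).swap := by
  have e1 : ((Z.m.toNat : ℕ) : ℝ) = Z.m := by
    exact_mod_cast congrArg (Int.cast (R := ℝ)) (Int.toNat_of_nonneg h.m_nonneg)
  have e2 : ((Z.n.toNat : ℕ) : ℝ) = Z.n := by
    exact_mod_cast congrArg (Int.cast (R := ℝ)) (Int.toNat_of_nonneg h.n_nonneg)
  simp [F, Quad.twist, Quad.swap, e1, e2]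

/-- The inequalities satisfied by the values of `F`. -/
def Reduced (Z : Quad) : Prop := Z.y₁ < Z.x₁ + Z.x₂ ∧ Z.y₂ < Z.x₁

lemma Renorm.reduced {Z : Quad} (h : Renorm Z) : Reduced (F Z) := by
  obtain ⟨h1, h2, h3, h4⟩ := h.pos
  have a1 := Int.lt_floor_add_one (Z.x₁ / (Z.y₁ + Z.y₂))
  have a2 := Int.lt_floor_add_one (Z.x₂ / Z.y₁)
  rw [div_lt_iff₀ (by positivity)] at a1 a2
  change _ < ((Z.m : ℝ) + 1) * _ at a1
  change _ < ((Z.n : ℝ) + 1) * _ at a2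
  constructor <;> simp only [F] <;> linarith

/-- If both quotients vanish, the floor inequalities supply exactly the half of `Quad.Blocked` not
contained in `Reduced`. -/
lemma Renorm.nontrivial {Z : Quad} (h : Renorm Z) (hr : Reduced Z) :
    Z.m.toNat ≠ 0 ∨ Z.n.toNat ≠ 0 := by
  by_contra! hc
  have hm : Z.m = 0 := by have := h.m_nonneg; omega
  have hn : Z.n = 0 := by have := h.n_nonneg; omega
  obtain ⟨h1, h2, h3, h4⟩ := h.pos
  have a1 := (Int.floor_eq_zero_iff.1 hm).2
  have a2 := (Int.floor_eq_zero_iff.1 hn).2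
  rw [div_lt_one (by positivity)] at a1 a2
  exact (h.ren 0).2 ⟨⟨hr.1, a2⟩, a1, hr.2⟩

/-- The renormalization of a word with both kinds of reflections. -/
lemma Renorm.step {Z : Quad} (h : Renorm Z) {f : ℝ} (hf : Generic Z f) {w : List Letter}
    (hv : Valid Z f w) (h2 : h₂ ∈ w) (h2' : v₂ ∈ w) :
    ∃ f' w', Generic (F Z) f' ∧ Valid (F Z) f' w' ∧ w'.length ≤ w.length ∧
      (Reduced Z → Inside v₁ w ∨ Inside h₁ w' → w'.length < w.length) ∧
      ∀ π : Params, π.Ok → ∃ π' : Params, π'.Ok ∧ (Sep π' w' → Sep π w) := by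
  set m := Z.m.toNat with hm
  set n := Z.n.toNat with hn
  have hF : F Z = (Z.twist m n).swap := h.F_eq
  have hT : (Z.twist m n).Pos := by
    have := h.next.pos.swap
    rwa [hF] at this
  have hne : Even n := by
    have h0 : Even Z.n := h.even 0
    rw [← Int.toNat_of_nonneg h.n_nonneg] at h0
    exact_mod_cast h0
  obtain ⟨f', a, u, a₂, ha, he, hc⟩ :=
    cover_of_valid h.pos hT hf (List.ne_nil_of_mem h2) hv
  rcases hc with ⟨v, rfl, -⟩ | ⟨mid, z, z₁, v, hv', hz, hz₁, ha₂, rfl⟩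
  · exact absurd ⟨by simp [ha, h2], by simp [ha, h2']⟩ (not_mem_sub m n a)
  -- The two points differ by `shiftSum Z u`, an integral combination of the entries. Otherwise its
  -- opposite would be generic, and so would 0 after adding `shiftSum Z u`.
  have hf' : Generic Z (f' - m * (Z.y₁ + Z.y₂)) := by
    intro i j k l e
    have : ∃ i' j' k' l' : ℤ, shiftSum Z u = i' * Z.x₁ + j' * Z.x₂ + k' * Z.y₁ + l' * Z.y₂ := by
      by_contra! hcon
      have := generic_shiftSum (w := u) (f := -shiftSum Z u) (Z := Z) (by
        intro i j k l e
        exact hcon (-i) (-j) (-k) (-l) (by push_cast; linarith))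
      exact this 0 0 0 0 (by simp)
    obtain ⟨i', j', k', l', e'⟩ := this
    exact hf (i + i') (j + j') (k + k') (l + l') (by rw [he, e, e']; push_cast; ring)
  refine ⟨-f', (a :: (mid ++ [z])).map Letter.swap, ?_, ?_, ?_, ?_, ?_⟩
  · rw [hF]; exact (generic_untwist hf').swap
  · rw [hF]; exact valid_swap hv'
  · have l1 := List.length_pos_of_ne_nil ha₂
    have l2 := List.length_pos_of_ne_nil hz₁
    have l3 := length_le_length_flatMap m n mid
    simp only [List.length_map, List.length_cons, List.length_append, List.length_nil]
    omega
  · intro hr hins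
    have l1 := List.length_pos_of_ne_nil ha₂
    have l2 := List.length_pos_of_ne_nil hz₁
    have l3 := length_le_length_flatMap m n mid
    by_cases hmid : v₁ ∈ mid
    · have l4 : mid.length < (mid.flatMap (sub m n)).length :=
        length_lt_length_flatMap (h.nontrivial hr) hmid
      simp only [List.length_map, List.length_cons, List.length_append, List.length_nil]
      omega
    -- Without shortening, both end pieces are single letters, so the interior of `w` is the image
    -- of `mid`; an interior `v₁` would then come from `mid`.
    · rcases hins with ⟨l₀, mid', l, e, hl⟩ | hins
      · by_contra hlen
        simp only [List.length_map, List.length_cons, List.length_append, List.length_nil] at hlen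
        obtain ⟨k, rfl⟩ := List.length_eq_one_iff.1 (show a₂.length = 1 by omega)
        obtain ⟨k', rfl⟩ := List.length_eq_one_iff.1 (show z₁.length = 1 by omega)
        obtain ⟨-, e⟩ := List.cons.inj (show k :: (mid.flatMap (sub m n) ++ [k']) = _ from e)
        obtain ⟨rfl, -⟩ := List.append_inj' e rfl
        exact hmid (v₁_mem_of_mem_flatMap hl)
      · obtain ⟨l₀, mid', l, e, hl⟩ := hins.swap
        simp only [List.map_map, Function.comp_def, Letter.swap_swap, List.map_id'] at e
        obtain ⟨-, e⟩ := List.cons.inj e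
        obtain ⟨rfl, -⟩ := List.append_inj' e rfl
        exact absurd hl hmid
  · intro π hπ
    refine ⟨(π.twist m n).swap, (hπ.twist m n).swap, fun hs => ?_⟩
    exact sep_of_cover hπ hne ha hz ha₂ hz₁ (sep_swap_iff.1 hs)

lemma Renorm.sep_of_reduced (N : ℕ) : ∀ {Z : Quad} {π : Params} {f : ℝ} {w : List Letter},
    Renorm Z → Reduced Z → π.Ok → Generic Z f → Valid Z f w → w.length ≤ N → Sep π w := by
  induction N with
  | zero =>
    intro Z π f w _ _ _ _ _ hw l₀ mid l g u v e
    simp [e] at hw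
  | succ N ih =>
    -- With an interior `v₁`, one renormalization already shortens the word.
    have key : ∀ {Z : Quad} {π : Params} {f : ℝ} {w : List Letter}, Renorm Z → Reduced Z → π.Ok →
        Generic Z f → Valid Z f w → w.length ≤ N + 1 → h₂ ∈ w → v₂ ∈ w → Inside v₁ w →
        Sep π w := by
      intro Z π f w hZ hr hπ hf hv hw h2 h2' hi
      obtain ⟨f', w', hf', hv', -, hlt, hs⟩ := hZ.step hf hv h2 h2'
      obtain ⟨π', hπ', hs⟩ := hs π hπ
      have := hlt hr (Or.inl hi)
      exact hs (ih hZ.next hZ.reduced hπ' hf' hv' (by omega))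
    intro Z π f w hZ hr hπ hf hv hw
    have hc := hv.isChain hZ.pos
    by_cases h2 : h₂ ∈ w
    swap; · exact sep_of_h₂_notMem hπ hc h2
    by_cases h2' : v₂ ∈ w
    swap; · exact sep_of_v₂_notMem hπ hc h2'
    obtain ⟨f', w', hf', hv', hle, hlt, hs⟩ := hZ.step hf hv h2 h2'
    obtain ⟨π', hπ', hs⟩ := hs π hπ
    refine hs ?_
    have hc' := hv'.isChain hZ.next.pos
    by_cases h3 : h₂ ∈ w'
    swap; · exact sep_of_h₂_notMem hπ' hc' h3
    by_cases h3' : v₂ ∈ w'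
    swap; · exact sep_of_v₂_notMem hπ' hc' h3'
    -- An interior `v₁` of `w'` shortens the word at the next step; an interior `h₁` of `w'` is,
    -- after the exchange of axes, a `v₁` of the covering word, so the step just made was already
    -- strict.
    rcases inside_of_mem hc' h3 h3' with hi | hi
    · exact key hZ.next hZ.reduced hπ' hf' hv' (by omega) h3 h3' hi
    · have := hlt hr (Or.inr hi)
      exact ih hZ.next hZ.reduced hπ' hf' hv' (by omega)

/-- The initial quadruple need not be reduced; one step, not required to shorten the word, makes it
so. -/
lemma Renorm.sep_of_generic {Z : Quad} (hZ : Renorm Z) {π : Params} (hπ : π.Ok) {f : ℝ}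
    (hf : Generic Z f) {w : List Letter} (hv : Valid Z f w) : Sep π w := by
  have hc := hv.isChain hZ.pos
  by_cases h2 : h₂ ∈ w
  swap; · exact sep_of_h₂_notMem hπ hc h2
  by_cases h2' : v₂ ∈ w
  swap; · exact sep_of_v₂_notMem hπ hc h2'
  obtain ⟨f', w', hf', hv', -, -, hs⟩ := hZ.step hf hv h2 h2'
  obtain ⟨π', hπ', hs⟩ := hs π hπ
  exact hs (hZ.next.sep_of_reduced _ hZ.reduced hπ' hf' hv' le_rfl)

lemma isOpen_dom (Z : Quad) (l : Letter) : IsOpen (dom Z l) := by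
  cases l <;> exact isOpen_Ioo

lemma isOpen_valid (Z : Quad) (w : List Letter) : IsOpen {f | Valid Z f w} := by
  induction w with
  | nil => simp
  | cons l w ih => exact (isOpen_dom Z l).inter (ih.preimage (by fun_prop))

lemma countable_not_generic (Z : Quad) : {f | ¬ Generic Z f}.Countable := by
  refine (Set.countable_range (fun t : ℤ × ℤ × ℤ × ℤ =>
    t.1 * Z.x₁ + t.2.1 * Z.x₂ + t.2.2.1 * Z.y₁ + t.2.2.2 * Z.y₂)).mono ?_
  intro f hf
  simp only [Generic, Set.mem_ofPred_eq, not_forall, not_not] at hf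
  obtain ⟨i, j, k, l, e⟩ := hf
  exact ⟨(i, j, k, l), e.symm⟩

lemma exists_generic (Z : Quad) {U : Set ℝ} (hU : IsOpen U) (hne : U.Nonempty) :
    ∃ f ∈ U, Generic Z f := by
  obtain ⟨f, hf, hfU⟩ := ((countable_not_generic Z).dense_compl ℝ).exists_mem_open hU hne
  exact ⟨f, hfU, by simpa using hf⟩

/-- Separation depends only on the word. The points with a given coding form an open set, so a
generic one may be chosen. -/
lemma Renorm.sep {Z : Quad} (hZ : Renorm Z) {π : Params} (hπ : π.Ok) {f : ℝ} {w : List Letter}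
    (hv : Valid Z f w) : Sep π w := by
  obtain ⟨f', hf', hg⟩ := exists_generic Z (isOpen_valid Z w) ⟨f, hv⟩
  exact hZ.sep_of_generic hπ hg hf'

/-- A word starting in the middle interval can be extended to the left by a passage. -/
lemma Renorm.sep_cons {Z : Quad} (hZ : Renorm Z) {π : Params} (hπ : π.Ok) {f : ℝ}
    {w : List Letter} (hv : Valid Z f w) (h1 : -Z.x₁ ≤ f) (h2 : f ≤ Z.y₁) :
    Sep π (h₁ :: w) ∨ Sep π (v₁ :: w) := by
  obtain ⟨z1, z2, z3, z4⟩ := hZ.pos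
  have hcl : f ∈ closure (Set.Ioo (-Z.x₁) Z.y₁) := by
    rw [closure_Ioo (by linarith)]; exact ⟨h1, h2⟩
  obtain ⟨f', hf', hg⟩ := exists_generic Z ((isOpen_valid Z w).inter isOpen_Ioo)
    (mem_closure_iff.1 hcl _ (isOpen_valid Z w) hv)
  have h0 := hg 0 0 0 0
  push_cast at h0
  -- The images of `h₁` and `v₁` are `(-x₁, 0)` and `(0, y₁)`, so the sign selects the letter to
  -- prepend.
  rcases lt_or_gt_of_ne h0 with h | h
  · left
    refine hZ.sep hπ (f := f' + (Z.y₁ + Z.y₂)) ⟨⟨?_, ?_⟩, ?_⟩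
    · linarith [hf'.2.1]
    · linarith
    · have h3 : Valid Z f' w := hf'.1
      convert h3 using 1
      simp only [shift]; ring
  · right
    refine hZ.sep hπ (f := f' - (Z.x₁ + Z.x₂)) ⟨⟨?_, ?_⟩, ?_⟩
    · linarith
    · linarith [hf'.2.2]
    · simpa [shift] using hf'.1

/-! ### Coordinates adapted to a frame -/

/-- The point at distance `U` of the entry of the cell `i` of a corridor, in the direction `ε`;
the cells have width `1 - a` and are separated by intervals of width `a`. -/
noncomputable def coord (a : ℝ) (i : ℤ) (ε : ℤˣ) (U : ℝ) : ℝ :=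
  i + 1 / 2 + ((ε : ℤ) : ℝ) * (U - (1 - a) / 2)

lemma coord_gap {a U : ℝ} (h0 : 0 < U) (h1 : U < 1 - a) (i : ℤ) (ε : ℤˣ) (k : ℤ) :
    a / 2 < |coord a i ε U - k| := by
  rw [lt_abs]
  rcases le_or_gt k i with h | h
  · left
    have : (k : ℝ) ≤ i := by exact_mod_cast h
    rcases Int.units_eq_one_or ε with rfl | rfl <;> simp [coord] <;> linarith
  · right
    have : (i : ℝ) + 1 ≤ k := by exact_mod_cast h
    rcases Int.units_eq_one_or ε with rfl | rfl <;> simp [coord] <;> linarith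

lemma coord_gap_le {a U : ℝ} (h0 : 0 ≤ U) (h1 : U ≤ 1 - a) (i : ℤ) (ε : ℤˣ) (k : ℤ) :
    a / 2 ≤ |coord a i ε U - k| := by
  rw [le_abs]
  rcases le_or_gt k i with h | h
  · left
    have : (k : ℝ) ≤ i := by exact_mod_cast h
    rcases Int.units_eq_one_or ε with rfl | rfl <;> simp [coord] <;> linarith
  · right
    have : (i : ℝ) + 1 ≤ k := by exact_mod_cast h
    rcases Int.units_eq_one_or ε with rfl | rfl <;> simp [coord] <;> linarith

lemma coord_bar {a U : ℝ} (h0 : 1 - a < U) (h1 : U < 1) (i : ℤ) (ε : ℤˣ) :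
    ∃ k : ℤ, |coord a i ε U - k| < a / 2 := by
  rcases Int.units_eq_one_or ε with rfl | rfl
  · refine ⟨i + 1, ?_⟩
    rw [abs_lt]
    simp [coord]
    constructor <;> linarith
  · refine ⟨i, ?_⟩
    rw [abs_lt]
    simp [coord]
    constructor <;> linarith

lemma coord_edge {a : ℝ} (ha : 0 < a) (i : ℤ) (ε : ℤˣ) :
    ∃ k : ℤ, |coord a i ε (1 - a) - k| = a / 2 := by
  rcases Int.units_eq_one_or ε with rfl | rfl
  · refine ⟨i + 1, ?_⟩
    rw [show coord a i 1 (1 - a) - ((i + 1 : ℤ) : ℝ) = -(a / 2) by simp [coord]; ring,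
      abs_neg, abs_of_pos (by linarith)]
  · refine ⟨i, ?_⟩
    rw [show coord a i (-1) (1 - a) - (i : ℝ) = a / 2 by simp [coord]; ring,
      abs_of_pos (by linarith)]

lemma coord_one (a : ℝ) (i : ℤ) (ε : ℤˣ) : coord a i ε 1 = coord a (i + ε) ε 0 := by
  rcases Int.units_eq_one_or ε with rfl | rfl <;> simp [coord] <;> ring

lemma coord_flip (a : ℝ) (i : ℤ) (ε : ℤˣ) : coord a i ε (1 - a) = coord a i (-ε) 0 := by
  rcases Int.units_eq_one_or ε with rfl | rfl <;> simp [coord] <;> ring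

lemma coord_edge_one {a : ℝ} (ha : 0 < a) (i : ℤ) (ε : ℤˣ) :
    ∃ k : ℤ, |coord a i ε 1 - k| = a / 2 := by
  have := coord_edge ha (i + ε) (-ε)
  rwa [coord_flip, neg_neg, ← coord_one] at this

lemma coord_add (a : ℝ) (i : ℤ) (ε : ℤˣ) (U r : ℝ) :
    coord a i ε (U + r) = coord a i ε U + ((ε : ℤ) : ℝ) * r := by
  simp only [coord]; ring

lemma coord_injective (a : ℝ) (i : ℤ) (ε : ℤˣ) : Function.Injective (coord a i ε) := by
  intro U U' h
  rcases Int.units_eq_one_or ε with rfl | rfl <;> simp [coord] at h <;> linarith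

lemma exists_coord (a x : ℝ) (ε : ℤˣ) : ∃ (i : ℤ) (U : ℝ), x = coord a i ε U ∧ 0 ≤ U ∧ U < 1 := by
  rcases Int.units_eq_one_or ε with rfl | rfl
  · refine ⟨⌊x - a / 2⌋, Int.fract (x - a / 2), ?_, Int.fract_nonneg _, Int.fract_lt_one _⟩
    simp only [coord, Int.fract]; push_cast; ring
  · refine ⟨-⌊-x - a / 2⌋ - 1, Int.fract (-x - a / 2), ?_, Int.fract_nonneg _,
      Int.fract_lt_one _⟩
    simp only [coord, Int.fract]; push_cast; ring

lemma abs_coord_sub_le {a U : ℝ} (ha : 0 < a) (ha' : a < 1) (h0 : 0 ≤ U) (h1 : U < 1) (i : ℤ)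
    (ε : ℤˣ) : |coord a i ε U - i| ≤ 2 := by
  rw [abs_le]
  rcases Int.units_eq_one_or ε with rfl | rfl <;> simp [coord] <;> constructor <;> linarith

open Classical in
/-- The index of the cell or of the separating interval of a point of a corridor. -/
noncomputable def cellIndex (a : ℝ) (i : ℤ) (ε : ℤˣ) (U : ℝ) : ℤ :=
  2 * i + if 1 - a < U then (ε : ℤ) else 0

/-- The index is a function of the point alone, so frames of opposite orientation can be compared.
Closed cells get even indices and the open gaps between them odd ones. -/
lemma cellIndex_congr {a : ℝ} (ha : 0 < a) (ha' : a < 1) {i i' : ℤ} {ε ε' : ℤˣ} {U U' : ℝ}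
    (hU : 0 ≤ U) (hU1 : U < 1) (hU' : 0 ≤ U') (hU1' : U' < 1)
    (h : coord a i ε U = coord a i' ε' U') : cellIndex a i ε U = cellIndex a i' ε' U' := by
  have key : ∀ k : ℤ, (-1 : ℝ) < k → (k : ℝ) < 1 → k = 0 := by
    intro k h1 h2
    have h1' : (-1 : ℤ) < k := by exact_mod_cast h1
    have h2' : k < 1 := by exact_mod_cast h2
    omega
  rcases Int.units_eq_one_or ε with rfl | rfl <;> rcases Int.units_eq_one_or ε' with rfl | rfl <;>
    simp only [coord, Units.val_one, Units.val_neg, Int.cast_one, Int.cast_neg] at h <;>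
    unfold cellIndex <;> split_ifs with h1 h2 h2
  · have := key (i - i') (by push_cast; linarith) (by push_cast; linarith); omega
  · have := key (i - i') (by push_cast; linarith) (by push_cast; linarith)
    have e : (i : ℝ) = i' := by exact_mod_cast (by omega : i = i')
    linarith
  · have := key (i - i') (by push_cast; linarith) (by push_cast; linarith)
    have e : (i : ℝ) = i' := by exact_mod_cast (by omega : i = i')
    linarith
  · have := key (i - i') (by push_cast; linarith) (by push_cast; linarith); omega
  · have := key (i + 1 - i') (by push_cast; linarith) (by push_cast; linarith)
    push_cast; omega
  · have := key (i - i') (by push_cast; linarith) (by push_cast; linarith)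
    have e : (i : ℝ) = i' := by exact_mod_cast (by omega : i = i')
    linarith
  · have := key (i + 1 - i') (by push_cast; linarith) (by push_cast; linarith)
    have e : (i : ℝ) + 1 = i' := by exact_mod_cast (by omega : i + 1 = i')
    linarith
  · have := key (i - i') (by push_cast; linarith) (by push_cast; linarith); omega
  · have := key (i' + 1 - i) (by push_cast; linarith) (by push_cast; linarith)
    push_cast; omega
  · have := key (i' + 1 - i) (by push_cast; linarith) (by push_cast; linarith)
    have e : (i' : ℝ) + 1 = i := by exact_mod_cast (by omega : i' + 1 = i)
    linarith
  · have := key (i - i') (by push_cast; linarith) (by push_cast; linarith)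
    have e : (i : ℝ) = i' := by exact_mod_cast (by omega : i = i')
    linarith
  · have := key (i - i') (by push_cast; linarith) (by push_cast; linarith); omega
  · have := key (i - i') (by push_cast; linarith) (by push_cast; linarith); omega
  · have := key (i - i') (by push_cast; linarith) (by push_cast; linarith)
    have e : (i : ℝ) = i' := by exact_mod_cast (by omega : i = i')
    linarith
  · have := key (i - i') (by push_cast; linarith) (by push_cast; linarith)
    have e : (i : ℝ) = i' := by exact_mod_cast (by omega : i = i')
    linarith
  · have := key (i - i') (by push_cast; linarith) (by push_cast; linarith); omega

lemma cellIndex_even_iff {a U U' : ℝ} {i i' : ℤ} {ε ε' : ℤˣ}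
    (h : cellIndex a i ε U = cellIndex a i' ε' U') : 1 - a < U ↔ 1 - a < U' := by
  unfold cellIndex at h
  constructor <;> intro h1 <;> by_contra h2 <;> simp only [if_pos h1, if_neg h2] at h
  · rcases Int.units_eq_one_or ε with rfl | rfl <;> push_cast at h <;> omega
  · rcases Int.units_eq_one_or ε' with rfl | rfl <;> push_cast at h <;> omega

/-! ### Points of the table and their reflections -/

/-- The point of coordinates `(U, V)` with respect to the frame `g`. -/
noncomputable def point (a b : ℝ) (g : Frame) (U V : ℝ) : Plane :=
  !₂[coord a g.x g.ε U, coord b g.y g.δ V]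

@[simp] lemma point_zero (a b : ℝ) (g : Frame) (U V : ℝ) :
    point a b g U V 0 = coord a g.x g.ε U := rfl

@[simp] lemma point_one (a b : ℝ) (g : Frame) (U V : ℝ) :
    point a b g U V 1 = coord b g.y g.δ V := rfl

/-- The direction of a frame. -/
def Frame.dir (g : Frame) : K := (g.ε, g.δ)

lemma point_add (a b θ : ℝ) (g : Frame) (U V r : ℝ) :
    point a b g (U + r * Real.cos θ) (V + r * Real.sin θ) =
      point a b g U V + r • dir θ g.dir := by
  ext i
  fin_cases i
  · simp [coord_add, dir, Frame.dir]; ring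
  · simp [coord_add, dir, Frame.dir]; ring

lemma reflection_eq_one {a b U V : ℝ} {g : Frame}
    (h : (0 < U ∧ U < 1 - a) ∨ (0 < V ∧ V < 1 - b)) : reflection a b (point a b g U V) = 1 := by
  have h1 : point a b g U V ∉ verticalSides a b := by
    rintro ⟨i, j, hi, hj⟩
    rw [point_zero] at hi
    rw [point_one] at hj
    rcases h with h | h
    · exact (coord_gap h.1 h.2 g.x g.ε i).ne' hi
    · exact (coord_gap h.1 h.2 g.y g.δ j).not_gt hj
  have h2 : point a b g U V ∉ horizontalSides a b := by
    rintro ⟨i, j, hi, hj⟩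
    rw [point_zero] at hi
    rw [point_one] at hj
    rcases h with h | h
    · exact (coord_gap h.1 h.2 g.x g.ε i).not_gt hi
    · exact (coord_gap h.1 h.2 g.y g.δ j).ne' hj
  simp [reflection, h1, h2]

lemma reflection_eq_τv {a b V : ℝ} (ha : 0 < a) {g : Frame} (h0 : 1 - b < V) (h1 : V < 1) :
    reflection a b (point a b g (1 - a) V) = τv := by
  obtain ⟨i, hi⟩ := coord_edge ha g.x g.ε
  obtain ⟨j, hj⟩ := coord_bar h0 h1 g.y g.δ
  have : point a b g (1 - a) V ∈ verticalSides a b := ⟨i, j, hi, hj⟩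
  simp [reflection, this]

lemma reflection_eq_τh {a b U : ℝ} (hb : 0 < b) (hb' : b < 1) {g : Frame} (h0 : 1 - a < U)
    (h1 : U < 1) : reflection a b (point a b g U (1 - b)) = τh := by
  obtain ⟨j, hj⟩ := coord_edge hb g.y g.δ
  obtain ⟨i, hi⟩ := coord_bar h0 h1 g.x g.ε
  have h2 : point a b g U (1 - b) ∈ horizontalSides a b := ⟨i, j, hi, hj⟩
  have h3 : point a b g U (1 - b) ∉ verticalSides a b := by
    rintro ⟨i, j, hi, hj⟩
    exact (coord_gap_le (by linarith) le_rfl g.y g.δ j).not_gt hj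
  simp [reflection, h2, h3]

lemma point_mem_table {a b U V : ℝ} {g : Frame}
    (h : (0 ≤ U ∧ U ≤ 1 - a) ∨ (0 ≤ V ∧ V ≤ 1 - b)) : point a b g U V ∈ table a b := by
  rintro i j ⟨hi, hj⟩
  rcases h with h | h
  · exact (coord_gap_le h.1 h.2 g.x g.ε i).not_gt hi
  · exact (coord_gap_le h.1 h.2 g.y g.δ j).not_gt hj

lemma point_notMem_table {a b U V : ℝ} {g : Frame} (hU : 1 - a < U) (hU' : U < 1)
    (hV : 1 - b < V) (hV' : V < 1) : point a b g U V ∉ table a b := by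
  obtain ⟨i, hi⟩ := coord_bar hU hU' g.x g.ε
  obtain ⟨j, hj⟩ := coord_bar hV hV' g.y g.δ
  exact fun h => h i j ⟨hi, hj⟩

lemma coord_bar_ne {a U : ℝ} (ha' : a < 1) (h0 : 1 - a < U) (h1 : U < 1) (i : ℤ) (ε : ℤˣ)
    (k : ℤ) : |coord a i ε U - k| ≠ a / 2 := by
  obtain ⟨k', hk'⟩ := coord_bar h0 h1 i ε
  intro h
  by_cases e : k = k'
  · subst e; linarith
  · have h2 : (1 : ℝ) ≤ |(k : ℝ) - k'| := by
      have : (1 : ℤ) ≤ |k - k'| := Int.one_le_abs (sub_ne_zero.2 e)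
      exact_mod_cast this
    have h3 : |(k : ℝ) - k'| ≤ |coord a i ε U - k| + |coord a i ε U - k'| := by
      have := abs_sub (coord a i ε U - k') (coord a i ε U - k)
      rw [show coord a i ε U - k' - (coord a i ε U - k) = (k : ℝ) - k' by ring] at this
      linarith
    linarith

lemma point_notMem_corners {a b U V : ℝ} (ha' : a < 1) (hb' : b < 1) {g : Frame}
    (h : (0 < U ∧ U < 1 - a) ∨ (0 < V ∧ V < 1 - b) ∨ (1 - a < U ∧ U < 1) ∨ (1 - b < V ∧ V < 1)) :
    point a b g U V ∉ corners a b := by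
  rintro ⟨i, j, hi, hj⟩
  rw [point_zero] at hi
  rw [point_one] at hj
  rcases h with h | h | h | h
  · exact (coord_gap h.1 h.2 g.x g.ε i).ne' hi
  · exact (coord_gap h.1 h.2 g.y g.δ j).ne' hj
  · exact coord_bar_ne ha' h.1 h.2 _ _ _ hi
  · exact coord_bar_ne hb' h.1 h.2 _ _ _ hj

/-! ### Straight flights -/

lemma K.mul_self (κ : K) : κ * κ = 1 := by
  ext <;> simp

/-- The description just before the end time is compared with the straight motion at one earlier
instant `t + r'`. Reflections are involutions, which yields the outgoing direction. -/
lemma IsForwardTrajectory.flight_aux {a b θ : ℝ} {γ : ℝ → Plane × K}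
    (hγ : IsForwardTrajectory a b θ γ) {t r : ℝ} (ht : 0 ≤ t) (hr0 : 0 < r)
    (hr : ∀ r', 0 ≤ r' → r' < r → γ (t + r') = ((γ t).1 + r' • dir θ (γ t).2, (γ t).2)) :
    γ (t + r) = ((γ t).1 + r • dir θ (γ t).2,
      reflection a b ((γ t).1 + r • dir θ (γ t).2) * (γ t).2) := by
  obtain ⟨ε, hε, h⟩ := hγ.before (t + r) (by linarith)
  set r' := max (r / 2) (r - ε / 2) with hr'
  have h1 : r' < r := max_lt (by linarith) (by linarith)
  have h2 : 0 ≤ r' := le_max_of_le_left (by linarith)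
  have h3 : r - ε < r' := lt_max_of_lt_right (by linarith)
  have e := (hr r' h2 h1).symm.trans (h (t + r') (by linarith) (by linarith) (by linarith))
  obtain ⟨e1, e2⟩ := Prod.ext_iff.1 e
  simp only at e1 e2
  rw [← e2] at e1
  have e3 : (γ (t + r)).1 = (γ t).1 + r • dir θ (γ t).2 := by
    have : (t + r - (t + r') : ℝ) = r - r' := by ring
    rw [this, sub_smul] at e1
    have := congrArg (fun p => p + (r • dir θ (γ t).2 - r' • dir θ (γ t).2)) e1
    simp only [sub_add_cancel] at this
    rw [← this]; abel
  refine Prod.ext e3 ?_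
  change _ = reflection a b _ * (γ t).2
  rw [← e3]
  rw [e2, ← mul_assoc, K.mul_self, one_mul]

/-- As long as no side is met, a trajectory is straight. -/
lemma IsForwardTrajectory.flight {a b θ : ℝ} {γ : ℝ → Plane × K}
    (hγ : IsForwardTrajectory a b θ γ) {t τ : ℝ} (ht : 0 ≤ t)
    (hfree : ∀ r, 0 < r → r < τ → reflection a b ((γ t).1 + r • dir θ (γ t).2) = 1) :
    ∀ r, 0 ≤ r → r < τ → γ (t + r) = ((γ t).1 + r • dir θ (γ t).2, (γ t).2) := by
  by_contra! hcon
  set S : Set ℝ := {r | 0 ≤ r ∧ r < τ ∧ γ (t + r) ≠ ((γ t).1 + r • dir θ (γ t).2, (γ t).2)}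
    with hS
  have hne : S.Nonempty := hcon
  have hbd : BddBelow S := ⟨0, fun r hr => hr.1⟩
  set r₀ := sInf S with hr₀
  have h0 : 0 ≤ r₀ := le_csInf hne fun r hr => hr.1
  have hτ : r₀ < τ := by
    obtain ⟨r, hr⟩ := hne
    exact (csInf_le hbd hr).trans_lt hr.2.1
  have hlt : ∀ r', 0 ≤ r' → r' < r₀ →
      γ (t + r') = ((γ t).1 + r' • dir θ (γ t).2, (γ t).2) := by
    intro r' h1 h2
    by_contra h3
    exact (csInf_le hbd (show r' ∈ S from ⟨h1, h2.trans hτ, h3⟩)).not_gt h2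
  have heq : γ (t + r₀) = ((γ t).1 + r₀ • dir θ (γ t).2, (γ t).2) := by
    rcases h0.eq_or_lt with h | h
    · rw [← h]; simp
    · have := hγ.flight_aux ht h hlt
      rwa [hfree r₀ h hτ, one_mul] at this
  obtain ⟨ε, hε, h⟩ := hγ.after (t + r₀) (by linarith)
  obtain ⟨r, hr, hr'⟩ := exists_lt_of_csInf_lt hne (show sInf S < r₀ + ε by linarith)
  refine hr.2.2 ?_
  rw [h (t + r) (by linarith [csInf_le hbd hr]) (by linarith), heq]
  simp only [Prod.mk.injEq, and_true]
  rw [add_assoc, ← add_smul]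
  congr 2
  ring

lemma IsForwardTrajectory.flight_end {a b θ : ℝ} {γ : ℝ → Plane × K}
    (hγ : IsForwardTrajectory a b θ γ) {t τ : ℝ} (ht : 0 ≤ t) (hτ : 0 < τ)
    (hfree : ∀ r, 0 < r → r < τ → reflection a b ((γ t).1 + r • dir θ (γ t).2) = 1) :
    γ (t + τ) = ((γ t).1 + τ • dir θ (γ t).2,
      reflection a b ((γ t).1 + τ • dir θ (γ t).2) * (γ t).2) :=
  hγ.flight_aux ht hτ (hγ.flight ht hfree)

/-! ### Orbits of the coding and visits to cells -/

/-- The parameters of the action of the letters on the cells of the table. -/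
def unitParams : Params := ⟨1, 0, 0, 1, 0, 0⟩

/-- The parameters of the action of the letters on the refined lattice, which contains the
crossings of corridors and the passages between them. -/
def doubleParams : Params := ⟨2, 0, 0, 2, 0, 0⟩

lemma doubleParams_ok : doubleParams.Ok := by
  constructor <;> simp [doubleParams]

/-- A frame, seen in the refined lattice. -/
def Frame.double (g : Frame) : Frame := ⟨2 * g.x, 2 * g.y, g.ε, g.δ⟩

lemma act_double (l : Letter) (g : Frame) :
    act doubleParams l g.double = (act unitParams l g).double := by
  cases l <;> ext <;> simp [act, Frame.double, doubleParams, unitParams] <;> ring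

/-- An infinite orbit of the interval exchange, with its coding and the visited frames. -/
structure IsOrbit (Z : Quad) (l : ℕ → Letter) (f : ℕ → ℝ) (g : ℕ → Frame) : Prop where
  mem_dom : ∀ n, f n ∈ dom Z (l n)
  f_succ : ∀ n, f (n + 1) = f n + shift Z (l n)
  g_succ : ∀ n, g (n + 1) = act unitParams (l n) (g n)

section Orbit

variable {Z : Quad} {l : ℕ → Letter} {f : ℕ → ℝ} {g : ℕ → Frame}

lemma IsOrbit.valid (h : IsOrbit Z l f g) (k : ℕ) :
    ∀ n, Valid Z (f n) ((List.range' n k).map l) := by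
  induction k with
  | zero => simp
  | succ k ih =>
    intro n
    rw [List.range'_succ, List.map_cons]
    exact ⟨h.mem_dom n, by rw [← h.f_succ]; exact ih (n + 1)⟩

lemma IsOrbit.actList (h : IsOrbit Z l f g) (k : ℕ) :
    ∀ n, actList doubleParams ((List.range' n k).map l) (g n).double = (g (n + k)).double := by
  induction k with
  | zero => simp
  | succ k ih =>
    intro n
    rw [List.range'_succ, List.map_cons, actList_cons, act_double, ← h.g_succ, ih]
    congr 2
    omega

/-- The boxes along an orbit are pairwise disjoint. -/
def BoxesDisjoint (l : ℕ → Letter) (g : ℕ → Frame) : Prop :=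
  ∀ n m u v, n < m → Box doubleParams (l n) (g n).double u v →
    ¬ Box doubleParams (l m) (g m).double u v

/-- For `doubleParams` the boxes of `h₂` and `v₂` are empty, while those of `h₁` and `v₁` consist of
the passage traversed and the crossing entered next. -/
lemma IsOrbit.boxesDisjoint (h : IsOrbit Z l f g) (hZ : Renorm Z) : BoxesDisjoint l g := by
  intro n m u v hnm h₀ h₁
  obtain ⟨k, rfl⟩ := Nat.exists_eq_add_of_lt hnm
  have hv := h.valid (k + 2) n
  refine hZ.sep doubleParams_ok hv (l n) ((List.range' (n + 1) k).map l) (l (n + k + 1)) _ u v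
    ?_ h₀ ?_
  · rw [List.range'_succ, List.range'_concat]
    simp
    congr 1
    omega
  · have := h.actList (k + 1) n
    rw [List.range'_succ, List.map_cons] at this
    rw [this]
    exact h₁

/-- No box of the orbit itself accounts for the starting crossing; a fictitious passage placed
before the orbit does. -/
lemma IsOrbit.box_ne_start (h : IsOrbit Z l f g) (hZ : Renorm Z) (h1 : -Z.x₁ ≤ f 0)
    (h2 : f 0 ≤ Z.y₁) (m : ℕ) :
    ¬ Box doubleParams (l m) (g m).double (2 * (g 0).x) (2 * (g 0).y) := by
  intro hb
  have hv := h.valid (m + 1) 0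
  have ha := h.actList m 0
  have hw : (List.range' 0 (m + 1)).map l = (List.range' 0 m).map l ++ [l m] := by
    rw [List.range'_concat]; simp
  rw [hw] at hv
  rw [zero_add] at ha
  rcases hZ.sep_cons doubleParams_ok hv h1 h2 with hs | hs
  · obtain ⟨g', hg'⟩ := act_surjective doubleParams h₁ (g 0).double
    refine hs h₁ _ (l m) g' _ _ rfl ?_ (by rw [actList_cons, hg', ha]; exact hb)
    have e1 : 2 * (g 0).x = g'.x + g'.ε * 2 := (congrArg Frame.x hg').symm
    have e2 : 2 * (g 0).y = g'.y + g'.δ * 0 := (congrArg Frame.y hg').symm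
    rw [e1, e2]
    simp [Box, doubleParams, ← mul_assoc]
  · obtain ⟨g', hg'⟩ := act_surjective doubleParams v₁ (g 0).double
    refine hs v₁ _ (l m) g' _ _ rfl ?_ (by rw [actList_cons, hg', ha]; exact hb)
    have e1 : 2 * (g 0).x = g'.x + g'.ε * 0 := (congrArg Frame.x hg').symm
    have e2 : 2 * (g 0).y = g'.y + g'.δ * 2 := (congrArg Frame.y hg').symm
    rw [e1, e2]
    simp [Box, doubleParams, ← mul_assoc]

lemma IsOrbit.adj (h : IsOrbit Z l f g) (hZ : Z.Pos) (n : ℕ) : Adj (l n) (l (n + 1)) := by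
  have := (h.valid 2 n).isChain hZ
  simpa [List.range'_succ] using this

lemma IsOrbit.swap (h : IsOrbit Z l f g) :
    IsOrbit Z.swap (fun n => (l n).swap) (fun n => -f n) (fun n => (g n).swap) := by
  refine ⟨fun n => ?_, fun n => ?_, fun n => ?_⟩
  · exact (valid_swap (w := [l n]) ⟨h.mem_dom n, trivial⟩).1
  · rw [h.f_succ]
    rcases l n <;> simp only [shift, Quad.swap, Letter.swap] <;> ring
  · simp only [h.g_succ]
    exact (act_swap unitParams (l n) (g n)).symm

lemma BoxesDisjoint.swap (h : BoxesDisjoint l g) :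
    BoxesDisjoint (fun n => (l n).swap) (fun n => (g n).swap) := by
  intro n m u v hnm h₀ h₁
  exact h n m v u hnm ((box_swap doubleParams _ _ _ _).1 h₀) ((box_swap doubleParams _ _ _ _).1 h₁)

/-- An orbit which is in a horizontal passage leaves it after finitely many reflections. -/
lemma IsOrbit.exists_h₁ (h : IsOrbit Z l f g) (hZ : Z.Pos) {n : ℕ} (hn : l n = h₁ ∨ l n = v₂) :
    ∃ N, n ≤ N ∧ l N = h₁ ∧ ∀ k, n ≤ k → k < N → l k = v₂ := by
  have hex : ∃ k, l (n + k) ≠ v₂ := by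
    by_contra! hc
    have hf : ∀ k : ℕ, f (n + k) = f n + k * Z.x₁ := by
      intro k
      induction k with
      | zero => simp
      | succ k ih =>
        rw [← add_assoc, h.f_succ, ih, hc k]
        simp only [shift]; push_cast; ring
    obtain ⟨k, hk⟩ := exists_nat_gt ((Z.y₁ + Z.y₂ - f n) / Z.x₁)
    rw [div_lt_iff₀ hZ.1] at hk
    have := (dom_subset hZ (h.mem_dom (n + k))).2
    rw [hf] at this
    linarith
  classical
  refine ⟨n + Nat.find hex, by omega, ?_, fun k hk hk' => ?_⟩
  · rcases hfind : Nat.find hex with _ | k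
    · have := Nat.find_spec hex
      rw [hfind] at this
      simpa using hn.resolve_right this
    · have h1 : l (n + k) = v₂ := by
        have := Nat.find_min hex (show k < Nat.find hex by omega)
        simpa using this
      have h2 := Nat.find_spec hex
      rw [hfind] at h2
      exact ((h.adj hZ (n + k)).1 h1).resolve_left h2
  · obtain ⟨j, rfl⟩ := Nat.exists_eq_add_of_le hk
    have := Nat.find_min hex (show j < Nat.find hex by omega)
    simpa using this

lemma IsOrbit.frame_of_v₂ (h : IsOrbit Z l f g) {n N : ℕ} (hN : n ≤ N)
    (hv : ∀ k, n ≤ k → k < N → l k = v₂) :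
    (g N).x = (g n).x ∧ (g N).y = (g n).y ∧ (g N).ε = (g n).ε := by
  induction N, hN using Nat.le_induction with
  | base => simp
  | succ N hN ih =>
    obtain ⟨h1, h2, h3⟩ := ih fun k hk hk' => hv k hk (by omega)
    rw [h.g_succ, hv N hN (by omega)]
    simp [act, unitParams, h1, h2, h3]

/-- A horizontal passage is visited during one interval of time only. -/
lemma IsOrbit.eq_v₂_of_passage (h : IsOrbit Z l f g) (hZ : Z.Pos) (hd : BoxesDisjoint l g)
    {n m : ℕ} (hn : l n = h₁ ∨ l n = v₂) (hm : l m = h₁ ∨ l m = v₂)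
    (hx : 2 * (g n).x + (g n).ε = 2 * (g m).x + (g m).ε) (hy : (g n).y = (g m).y) :
    ∀ k, n ≤ k → k < m → l k = v₂ := by
  obtain ⟨N, hN, hN1, hN2⟩ := h.exists_h₁ hZ hn
  obtain ⟨M, hM, hM1, hM2⟩ := h.exists_h₁ hZ hm
  obtain ⟨a1, a2, a3⟩ := h.frame_of_v₂ hN hN2
  obtain ⟨b1, b2, b3⟩ := h.frame_of_v₂ hM hM2
  have hb : Box doubleParams (l N) (g N).double (2 * (g n).x + (g n).ε) (2 * (g n).y) := by
    rw [hN1]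
    simp only [Box, Frame.double, a1, a2, a3, doubleParams]
    simp
  have hb' : Box doubleParams (l M) (g M).double (2 * (g n).x + (g n).ε) (2 * (g n).y) := by
    rw [hM1, hx, hy]
    simp only [Box, Frame.double, b1, b2, b3, doubleParams]
    simp
  obtain rfl : N = M := by
    rcases lt_trichotomy N M with hlt | rfl | hlt
    · exact absurd hb' (hd _ _ _ _ hlt hb)
    · rfl
    · exact absurd hb (hd _ _ _ _ hlt hb')
  exact fun k hk hk' => hN2 k hk (by omega)

/-- Every crossing of corridors is visited finitely often. -/
lemma IsOrbit.finite_visits (h : IsOrbit Z l f g) (hZ : Z.Pos) (hd : BoxesDisjoint l g) (i j : ℤ) :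
    {n | (g n).x = i ∧ (g n).y = j}.Finite := by
  classical
  set D : Set ℕ := {n | ((g n).x = i ∧ (g n).y = j) ∧ (l n = h₁ ∨ l n = v₁)} with hD
  have hDfin : D.Finite := by
    -- The passage through which the crossing is left. It lies in a 3 by 3 block, and disjointness
    -- of boxes makes the choice injective.
    let φ : ℕ → ℤ × ℤ := fun n =>
      if l n = h₁ then (2 * i + (g n).ε, 2 * j) else (2 * i, 2 * j + (g n).δ)
    have hbox : ∀ n ∈ D, Box doubleParams (l n) (g n).double (φ n).1 (φ n).2 := by
      rintro n ⟨⟨rfl, rfl⟩, hl | hl⟩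
      · simp [φ, hl, Box, Frame.double, doubleParams]
      · simp [φ, hl, Box, Frame.double, doubleParams]
    refine Set.Finite.of_injOn (f := φ)
      (t := Set.Icc (2 * i - 1) (2 * i + 1) ×ˢ Set.Icc (2 * j - 1) (2 * j + 1)) ?_ ?_
      ((Set.finite_Icc _ _).prod (Set.finite_Icc _ _))
    · intro n _
      simp only [φ]
      split_ifs
      · rcases Int.units_eq_one_or (g n).ε with e | e <;> simp [e] <;> omega
      · rcases Int.units_eq_one_or (g n).δ with e | e <;> simp [e] <;> omega
    · intro n hn m hm e
      have hbn := hbox n hn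
      have hbm := hbox m hm
      rw [← e] at hbm
      rcases lt_trichotomy n m with hlt | heq | hlt
      · exact absurd hbm (hd _ _ _ _ hlt hbn)
      · exact heq
      · exact absurd hbn (hd _ _ _ _ hlt hbm)
  by_contra hinf
  obtain ⟨B, hB⟩ := hDfin.bddAbove
  obtain ⟨n, hn, hBn⟩ := Set.Infinite.exists_gt hinf B
  have : ∃ N, n ≤ N ∧ N ∈ D := by
    have key : ∀ {Z : Quad} {l : ℕ → Letter} {f : ℕ → ℝ} {g : ℕ → Frame}, IsOrbit Z l f g →
        Z.Pos → (l n = h₁ ∨ l n = v₂) →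
        ∃ N, n ≤ N ∧ l N = h₁ ∧ (g N).x = (g n).x ∧ (g N).y = (g n).y := by
      intro Z l f g h hZ hl
      obtain ⟨N, hN, hN1, hN2⟩ := h.exists_h₁ hZ hl
      obtain ⟨a1, a2, -⟩ := h.frame_of_v₂ hN hN2
      exact ⟨N, hN, hN1, a1, a2⟩
    by_cases hl : l n = h₁ ∨ l n = v₂
    · obtain ⟨N, hN, hN1, a1, a2⟩ := key h hZ hl
      exact ⟨N, hN, ⟨a1.trans hn.1, a2.trans hn.2⟩, Or.inl hN1⟩
    · obtain ⟨N, hN, hN1, a1, a2⟩ := key h.swap hZ.swap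
        (by rcases hl' : l n <;> simp_all [Letter.swap])
      refine ⟨N, hN, ⟨a2.trans hn.1, a1.trans hn.2⟩, Or.inr ?_⟩
      rcases hl' : l N <;> simp_all [Letter.swap]
  obtain ⟨N, hN, hND⟩ := this
  have := hB hND
  omega

end Orbit

/-! ### The discrete dynamics of a trajectory -/

/-- The standing assumptions on the table and on the direction. -/
structure Admissible (a b θ : ℝ) : Prop where
  a_pos : 0 < a
  a_lt : a < 1
  b_pos : 0 < b
  b_lt : b < 1
  cos_pos : 0 < Real.cos θ
  sin_pos : 0 < Real.sin θ

lemma Admissible.pos {a b θ : ℝ} (h : Admissible a b θ) : (quadOf a b θ).Pos :=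
  ⟨mul_pos (by linarith [h.b_lt]) h.cos_pos, mul_pos h.b_pos h.cos_pos,
    mul_pos (by linarith [h.a_lt]) h.sin_pos, mul_pos h.a_pos h.sin_pos⟩

/-- A frame together with the coordinates of a point with respect to it. -/
structure State where
  g : Frame
  U : ℝ
  V : ℝ

/-- The coordinates lie in the half-open L-shaped region. -/
structure InL (a b U V : ℝ) : Prop where
  U_nonneg : 0 ≤ U
  U_lt : U < 1
  V_nonneg : 0 ≤ V
  V_lt : V < 1
  or : U < 1 - a ∨ V < 1 - b

/-- The coordinate transverse to the direction `θ`. -/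
noncomputable def State.f (θ : ℝ) (st : State) : ℝ := st.U * Real.sin θ - st.V * Real.cos θ

/-- The duration of the flight coded by a letter. -/
noncomputable def flightTime (a b θ : ℝ) (st : State) : Letter → ℝ
  | h₁ => (1 - st.U) / Real.cos θ
  | h₂ => (1 - a - st.U) / Real.cos θ
  | v₁ => (1 - st.V) / Real.sin θ
  | v₂ => (1 - b - st.V) / Real.sin θ

/-- The conditions on the coordinates at the end of a flight. -/
def ExitAt (a b : ℝ) (l : Letter) (U V : ℝ) : Prop :=
  match l with
  | h₁ => U = 1 ∧ 0 < V ∧ V < 1 - b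
  | h₂ => U = 1 - a ∧ 1 - b < V ∧ V < 1
  | v₁ => V = 1 ∧ 0 < U ∧ U < 1 - a
  | v₂ => V = 1 - b ∧ 1 - a < U ∧ U < 1

/-- The state after the flight coded by a letter. -/
noncomputable def nextState (a b θ : ℝ) (st : State) (l : Letter) : State where
  g := act unitParams l st.g
  U := match l with
    | h₁ => 0
    | h₂ => 0
    | _ => st.U + flightTime a b θ st l * Real.cos θ
  V := match l with
    | v₁ => 0
    | v₂ => 0
    | _ => st.V + flightTime a b θ st l * Real.sin θ

/-! ### A single flight in the L-shaped cell -/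

section Flight

variable {a b θ : ℝ} {st : State} {l : Letter}

lemma State.f_mem (hA : Admissible a b θ) (hL : InL a b st.U st.V) :
    -Real.cos θ < st.f θ ∧ st.f θ < Real.sin θ := by
  have hc := hA.cos_pos
  have hs := hA.sin_pos
  have h1 : st.U * Real.sin θ < 1 * Real.sin θ := by gcongr; exact hL.U_lt
  have h2 : st.V * Real.cos θ < 1 * Real.cos θ := by gcongr; exact hL.V_lt
  have h3 : 0 ≤ st.U * Real.sin θ := mul_nonneg hL.U_nonneg hs.le
  have h4 : 0 ≤ st.V * Real.cos θ := mul_nonneg hL.V_nonneg hc.le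
  constructor <;> simp only [State.f] <;> linarith

lemma flightTime_pos (hA : Admissible a b θ) (hL : InL a b st.U st.V)
    (hf : st.f θ ∈ dom (quadOf a b θ) l) : 0 < flightTime a b θ st l := by
  have hc := hA.cos_pos
  have hs := hA.sin_pos
  cases l
  · exact div_pos (by linarith [hL.U_lt]) hc
  · refine div_pos ?_ hc
    by_contra hcon
    have h1 : 1 - a ≤ st.U := by linarith
    have h2 : st.V < 1 - b := hL.or.resolve_left h1.not_gt
    have h3 : (1 - a) * Real.sin θ ≤ st.U * Real.sin θ := by gcongr
    have h4 : st.V * Real.cos θ < (1 - b) * Real.cos θ := by gcongr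
    simp only [dom, quadOf, State.f, Set.mem_Ioo] at hf
    linarith [hf.2]
  · exact div_pos (by linarith [hL.V_lt]) hs
  · refine div_pos ?_ hs
    by_contra hcon
    have h1 : 1 - b ≤ st.V := by linarith
    have h2 : st.U < 1 - a := hL.or.resolve_right h1.not_gt
    have h3 : (1 - b) * Real.cos θ ≤ st.V * Real.cos θ := by gcongr
    have h4 : st.U * Real.sin θ < (1 - a) * Real.sin θ := by gcongr
    simp only [dom, quadOf, State.f, Set.mem_Ioo] at hf
    linarith [hf.1]

lemma flightTime_mul_cos (hA : Admissible a b θ) :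
    flightTime a b θ st h₁ * Real.cos θ = 1 - st.U ∧
      flightTime a b θ st h₂ * Real.cos θ = 1 - a - st.U :=
  ⟨div_mul_cancel₀ _ hA.cos_pos.ne', div_mul_cancel₀ _ hA.cos_pos.ne'⟩

lemma flightTime_mul_sin (hA : Admissible a b θ) :
    flightTime a b θ st v₁ * Real.sin θ = 1 - st.V ∧
      flightTime a b θ st v₂ * Real.sin θ = 1 - b - st.V :=
  ⟨div_mul_cancel₀ _ hA.sin_pos.ne', div_mul_cancel₀ _ hA.sin_pos.ne'⟩

lemma exitAt_flightTime (hA : Admissible a b θ) (hL : InL a b st.U st.V)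
    (hf : st.f θ ∈ dom (quadOf a b θ) l) :
    ExitAt a b l (st.U + flightTime a b θ st l * Real.cos θ)
      (st.V + flightTime a b θ st l * Real.sin θ) := by
  have hτ := flightTime_pos hA hL hf
  have hc := hA.cos_pos
  have hs := hA.sin_pos
  have c1 := flightTime_mul_cos (st := st) hA
  have s1 := flightTime_mul_sin (st := st) hA
  set τ := flightTime a b θ st l with hτdef
  have p1 : 0 < τ * Real.cos θ := by positivity
  have p2 : 0 < τ * Real.sin θ := by positivity
  have e : τ * Real.cos θ * Real.sin θ = τ * Real.sin θ * Real.cos θ := by ring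
  have u0 := hL.U_nonneg
  have v0 := hL.V_nonneg
  cases l <;> simp only [dom, quadOf, State.f, Set.mem_Ioo] at hf
  · rw [← hτdef] at c1
    rw [c1.1] at e
    refine ⟨by linarith, by linarith, ?_⟩
    refine lt_of_mul_lt_mul_right ?_ hc.le
    linarith [hf.1]
  · rw [← hτdef] at c1
    rw [c1.2] at e
    refine ⟨by linarith, ?_, ?_⟩
    · refine lt_of_mul_lt_mul_right ?_ hc.le
      linarith [hf.2]
    · refine lt_of_mul_lt_mul_right ?_ hc.le
      linarith [hf.1]
  · rw [← hτdef] at s1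
    rw [s1.1] at e
    refine ⟨by linarith, by linarith, ?_⟩
    refine lt_of_mul_lt_mul_right ?_ hs.le
    linarith [hf.2]
  · rw [← hτdef] at s1
    rw [s1.2] at e
    refine ⟨by linarith, ?_, ?_⟩
    · refine lt_of_mul_lt_mul_right ?_ hs.le
      linarith [hf.1]
    · refine lt_of_mul_lt_mul_right ?_ hs.le
      linarith [hf.2]

/-- During a flight which ends in the closed L-shaped region, the coordinates remain in its
interior. -/
lemma inL_flight (hA : Admissible a b θ) (hL : InL a b st.U st.V) {τ r : ℝ}
    (h1 : st.U + τ * Real.cos θ ≤ 1) (h2 : st.V + τ * Real.sin θ ≤ 1)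
    (h3 : st.U + τ * Real.cos θ ≤ 1 - a ∨ st.V + τ * Real.sin θ ≤ 1 - b) (hr : 0 < r)
    (hrτ : r < τ) :
    InL a b (st.U + r * Real.cos θ) (st.V + r * Real.sin θ) ∧ 0 < st.U + r * Real.cos θ ∧
      0 < st.V + r * Real.sin θ := by
  have hc := hA.cos_pos
  have hs := hA.sin_pos
  have u0 := hL.U_nonneg
  have v0 := hL.V_nonneg
  have p1 : 0 < r * Real.cos θ := by positivity
  have p2 : 0 < r * Real.sin θ := by positivity
  have q1 : r * Real.cos θ < τ * Real.cos θ := by gcongr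
  have q2 : r * Real.sin θ < τ * Real.sin θ := by gcongr
  refine ⟨⟨by linarith, by linarith, by linarith, by linarith, ?_⟩, by linarith, by linarith⟩
  rcases h3 with h3 | h3
  · left; linarith
  · right; linarith

lemma ExitAt.le (hA : Admissible a b θ) {U V : ℝ} (h : ExitAt a b l U V) :
    U ≤ 1 ∧ V ≤ 1 ∧ (U ≤ 1 - a ∨ V ≤ 1 - b) := by
  have := hA.a_pos
  have := hA.b_pos
  cases l <;> obtain ⟨h1, h2, h3⟩ := h
  · exact ⟨h1.le, by linarith, Or.inr h3.le⟩
  · exact ⟨by linarith, h3.le, Or.inl h1.le⟩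
  · exact ⟨by linarith, h1.le, Or.inl h3.le⟩
  · exact ⟨h3.le, by linarith, Or.inr h1.le⟩

lemma InL.reflection_eq_one {U V : ℝ} (hL : InL a b U V) (hU : 0 < U) (hV : 0 < V) (g : Frame) :
    reflection a b (point a b g U V) = 1 :=
  WindTree.reflection_eq_one (hL.or.imp (fun h => ⟨hU, h⟩) (fun h => ⟨hV, h⟩))

/-- The end of a flight, in terms of the next state. -/
lemma ExitAt.point_eq (hA : Admissible a b θ)
    (h : ExitAt a b l (st.U + flightTime a b θ st l * Real.cos θ)
      (st.V + flightTime a b θ st l * Real.sin θ)) :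
    point a b st.g (st.U + flightTime a b θ st l * Real.cos θ)
        (st.V + flightTime a b θ st l * Real.sin θ) =
      point a b (nextState a b θ st l).g (nextState a b θ st l).U (nextState a b θ st l).V ∧
    reflection a b (point a b st.g (st.U + flightTime a b θ st l * Real.cos θ)
        (st.V + flightTime a b θ st l * Real.sin θ)) * st.g.dir =
      (nextState a b θ st l).g.dir := by
  cases l <;> obtain ⟨h1, h2, h3⟩ := h
  · rw [WindTree.reflection_eq_one (Or.inr ⟨h2, h3⟩), h1]
    simp [point, nextState, act, unitParams, coord_one, Frame.dir]
  · rw [h1, reflection_eq_τv hA.a_pos h2 h3]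
    simp [point, nextState, act, unitParams, coord_flip, Frame.dir, τv]
  · rw [WindTree.reflection_eq_one (Or.inl ⟨h2, h3⟩), h1]
    simp [point, nextState, act, unitParams, coord_one, Frame.dir]
  · rw [h1, reflection_eq_τh hA.b_pos hA.b_lt h2 h3]
    simp [point, nextState, act, unitParams, coord_flip, Frame.dir, τh]

lemma inL_nextState (hA : Admissible a b θ) (hL : InL a b st.U st.V)
    (hf : st.f θ ∈ dom (quadOf a b θ) l) :
    InL a b (nextState a b θ st l).U (nextState a b θ st l).V := by
  have h := exitAt_flightTime hA hL hf
  have := hA.a_pos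
  have := hA.b_pos
  have := hA.a_lt
  have := hA.b_lt
  cases l <;> obtain ⟨h1, h2, h3⟩ := h <;> simp only [nextState]
  · exact ⟨le_rfl, one_pos, h2.le, by linarith, Or.inr h3⟩
  · exact ⟨le_rfl, one_pos, by linarith, h3, Or.inl (by linarith)⟩
  · exact ⟨h2.le, by linarith, le_rfl, one_pos, Or.inl h3⟩
  · exact ⟨by linarith, h3, le_rfl, one_pos, Or.inr (by linarith)⟩

/-- The flight itself preserves the transverse coordinate; the shift comes only from recentring at
the new frame. -/
lemma f_nextState (hA : Admissible a b θ) (l : Letter) :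
    (nextState a b θ st l).f θ = st.f θ + shift (quadOf a b θ) l := by
  have c1 := flightTime_mul_cos (st := st) hA
  have s1 := flightTime_mul_sin (st := st) hA
  have e : ∀ l, flightTime a b θ st l * Real.cos θ * Real.sin θ =
      flightTime a b θ st l * Real.sin θ * Real.cos θ := fun l => by ring
  have e1 := e h₁
  have e2 := e h₂
  have e3 := e v₁
  have e4 := e v₂
  rw [c1.1] at e1
  rw [c1.2] at e2
  rw [s1.1] at e3
  rw [s1.2] at e4
  cases l <;> simp only [nextState, State.f, shift, quadOf] <;> linarith

/-- The letter of the flight starting at a given state. -/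
noncomputable def letterOf (Z : Quad) (f : ℝ) : Letter :=
  open Classical in
  if h : ∃ l, f ∈ dom Z l then h.choose else h₁

lemma mem_dom_letterOf {Z : Quad} {f : ℝ} (h : ∃ l, f ∈ dom Z l) : f ∈ dom Z (letterOf Z f) := by
  rw [letterOf, dif_pos h]
  exact h.choose_spec

end Flight

/-! ### Iterated flights and their starting times -/

section Sequence

variable (a b θ : ℝ) (st₀ : State)

/-- The sequence of states of a trajectory. -/
noncomputable def stateSeq : ℕ → State
  | 0 => st₀
  | n + 1 => nextState a b θ (stateSeq n) (letterOf (quadOf a b θ) ((stateSeq n).f θ))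

/-- The coding of a trajectory. -/
noncomputable def letterSeq (n : ℕ) : Letter :=
  letterOf (quadOf a b θ) ((stateSeq a b θ st₀ n).f θ)

/-- The sequence of times at which the flights of a trajectory begin. -/
noncomputable def timeSeq : ℕ → ℝ
  | 0 => 0
  | n + 1 => timeSeq n +
      flightTime a b θ (stateSeq a b θ st₀ n) (letterSeq a b θ st₀ n)

variable {a b θ : ℝ} {st₀ : State}

lemma stateSeq_succ (n : ℕ) : stateSeq a b θ st₀ (n + 1) =
    nextState a b θ (stateSeq a b θ st₀ n) (letterSeq a b θ st₀ n) := rfl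

lemma timeSeq_succ (n : ℕ) : timeSeq a b θ st₀ (n + 1) = timeSeq a b θ st₀ n +
      flightTime a b θ (stateSeq a b θ st₀ n) (letterSeq a b θ st₀ n) := rfl

/-- The flights of the sequence of states never end at a corner. -/
def Regular (a b θ : ℝ) (st₀ : State) : Prop :=
  ∀ n, (stateSeq a b θ st₀ n).f θ ∈ dom (quadOf a b θ) (letterSeq a b θ st₀ n)

lemma Regular.inL (hA : Admissible a b θ) (hL : InL a b st₀.U st₀.V) (hR : Regular a b θ st₀)
    (n : ℕ) : InL a b (stateSeq a b θ st₀ n).U (stateSeq a b θ st₀ n).V := by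
  induction n with
  | zero => exact hL
  | succ n ih => exact inL_nextState hA ih (hR n)

lemma Regular.isOrbit (hA : Admissible a b θ) (hR : Regular a b θ st₀) :
    IsOrbit (quadOf a b θ) (letterSeq a b θ st₀) (fun n => (stateSeq a b θ st₀ n).f θ)
      (fun n => (stateSeq a b θ st₀ n).g) :=
  ⟨hR, fun _ => f_nextState hA _, fun _ => rfl⟩

lemma Regular.timeSeq_lt (hA : Admissible a b θ) (hL : InL a b st₀.U st₀.V)
    (hR : Regular a b θ st₀) (n : ℕ) : timeSeq a b θ st₀ n < timeSeq a b θ st₀ (n + 1) := by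
  rw [timeSeq_succ]
  linarith [flightTime_pos hA (hR.inL hA hL n) (hR n)]

lemma Regular.timeSeq_strictMono (hA : Admissible a b θ) (hL : InL a b st₀.U st₀.V)
    (hR : Regular a b θ st₀) : StrictMono (timeSeq a b θ st₀) :=
  strictMono_nat_of_lt_succ (hR.timeSeq_lt hA hL)

/-- Along a flight `U + V` grows at speed `cos θ + sin θ`, and each change of frame takes away at
least `min (1 - a) (1 - b)`. Flight times therefore cannot accumulate. -/
lemma Regular.timeSeq_ge (hA : Admissible a b θ) (n : ℕ) :
    (stateSeq a b θ st₀ n).U + (stateSeq a b θ st₀ n).V - st₀.U - st₀.V +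
        n * min (1 - a) (1 - b) ≤
      (Real.cos θ + Real.sin θ) * timeSeq a b θ st₀ n := by
  induction n with
  | zero => simp [stateSeq, timeSeq]
  | succ n ih =>
    rw [timeSeq_succ, stateSeq_succ]
    have m1 := min_le_left (1 - a) (1 - b)
    have m2 := min_le_right (1 - a) (1 - b)
    have := hA.a_pos
    have := hA.b_pos
    set st := stateSeq a b θ st₀ n
    have c1 := flightTime_mul_cos (st := st) hA
    have s1 := flightTime_mul_sin (st := st) hA
    push_cast
    rcases letterSeq a b θ st₀ n <;> simp only [nextState] <;> linarith

lemma Regular.tendsto_timeSeq (hA : Admissible a b θ) (hL : InL a b st₀.U st₀.V)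
    (hR : Regular a b θ st₀) :
    Filter.Tendsto (timeSeq a b θ st₀) Filter.atTop Filter.atTop := by
  have hpos : 0 < Real.cos θ + Real.sin θ := add_pos hA.cos_pos hA.sin_pos
  have hm : 0 < min (1 - a) (1 - b) :=
    lt_min (by linarith [hA.a_lt]) (by linarith [hA.b_lt])
  have h1 : Filter.Tendsto (fun n : ℕ => (-2 + n * min (1 - a) (1 - b)) /
      (Real.cos θ + Real.sin θ)) Filter.atTop Filter.atTop :=
    (Filter.tendsto_atTop_add_const_left _ _
      (tendsto_natCast_atTop_atTop.atTop_mul_const hm)).atTop_div_const hpos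
  refine Filter.tendsto_atTop_mono (fun n => ?_) h1
  rw [div_le_iff₀ hpos]
  have h2 := Regular.timeSeq_ge (st₀ := st₀) hA n
  have h3 := hR.inL hA hL n
  linarith [h3.U_nonneg, h3.V_nonneg, hL.U_lt, hL.V_lt]

lemma Regular.exists_index (hA : Admissible a b θ) (hL : InL a b st₀.U st₀.V)
    (hR : Regular a b θ st₀) {t : ℝ} (ht : 0 ≤ t) :
    ∃ n, timeSeq a b θ st₀ n ≤ t ∧ t < timeSeq a b θ st₀ (n + 1) := by
  have hex : ∃ n, t < timeSeq a b θ st₀ n :=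
    ((hR.tendsto_timeSeq hA hL).eventually_gt_atTop t).exists
  classical
  rcases hfind : Nat.find hex with _ | n
  · have := Nat.find_spec hex
    rw [hfind] at this
    exact absurd this (not_lt.2 ht)
  · refine ⟨n, ?_, ?_⟩
    · exact not_lt.1 (Nat.find_min hex (by omega))
    · have := Nat.find_spec hex
      rwa [hfind] at this

end Sequence

/-! ### Trajectories follow the discrete dynamics -/

section Trajectory

variable {a b θ : ℝ} {γ : ℝ → Plane × K}

/-- The state `st` describes the trajectory `γ` at time `t`. -/
def Describes (a b : ℝ) (γ : ℝ → Plane × K) (t : ℝ) (st : State) : Prop :=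
  γ t = (point a b st.g st.U st.V, st.g.dir)

lemma Describes.free (hA : Admissible a b θ) {t τ : ℝ} {st : State}
    (hst : Describes a b γ t st) (hL : InL a b st.U st.V) (h1 : st.U + τ * Real.cos θ ≤ 1)
    (h2 : st.V + τ * Real.sin θ ≤ 1)
    (h3 : st.U + τ * Real.cos θ ≤ 1 - a ∨ st.V + τ * Real.sin θ ≤ 1 - b) :
    ∀ r, 0 < r → r < τ → reflection a b ((γ t).1 + r • dir θ (γ t).2) = 1 := by
  intro r hr hrτ
  obtain ⟨i1, i2, i3⟩ := inL_flight hA hL h1 h2 h3 hr hrτ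
  rw [hst, ← point_add]
  exact i1.reflection_eq_one i2 i3 _

lemma not_corner_end (hA : Admissible a b θ) (hγ : IsForwardTrajectory a b θ γ) {t τ : ℝ}
    (ht : 0 ≤ t) (hτ : 0 < τ) {st : State} (hst : Describes a b γ t st) (hL : InL a b st.U st.V)
    (h : (st.U + τ * Real.cos θ = 1 - a ∧ st.V + τ * Real.sin θ = 1 - b) ∨
      (st.U + τ * Real.cos θ = 1 ∧ st.V + τ * Real.sin θ = 1 - b) ∨
      (st.U + τ * Real.cos θ = 1 - a ∧ st.V + τ * Real.sin θ = 1)) : False := by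
  have := hA.a_pos
  have := hA.b_pos
  have hfree := hst.free hA hL (τ := τ)
    (by rcases h with h | h | h <;> linarith [h.1]) (by rcases h with h | h | h <;> linarith [h.2])
    (by rcases h with h | h | h
        · exact Or.inl h.1.le
        · exact Or.inr h.2.le
        · exact Or.inl h.1.le)
  have hend := hγ.flight_end ht hτ hfree
  refine hγ.not_corner (t + τ) (by linarith) ?_
  rw [hend, hst]
  simp only [← point_add]
  obtain ⟨i, hi⟩ := coord_edge hA.a_pos st.g.x st.g.ε
  obtain ⟨j, hj⟩ := coord_edge hA.b_pos st.g.y st.g.δ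
  obtain ⟨i', hi'⟩ := coord_edge_one hA.a_pos st.g.x st.g.ε
  obtain ⟨j', hj'⟩ := coord_edge_one hA.b_pos st.g.y st.g.δ
  rcases h with ⟨h1, h2⟩ | ⟨h1, h2⟩ | ⟨h1, h2⟩ <;> rw [h1, h2]
  · exact ⟨i, j, hi, hj⟩
  · exact ⟨i', j, hi', hj⟩
  · exact ⟨i, j', hi, hj'⟩

/-- The three interior endpoints of the intervals are the transverse coordinates of three corners of
the L; a trajectory with such a value would run into that corner. -/
lemma exists_mem_dom (hA : Admissible a b θ) (hγ : IsForwardTrajectory a b θ γ) {t : ℝ}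
    (ht : 0 ≤ t) {st : State} (hst : Describes a b γ t st) (hL : InL a b st.U st.V) :
    ∃ l, st.f θ ∈ dom (quadOf a b θ) l := by
  have hc := hA.cos_pos
  have hs := hA.sin_pos
  obtain ⟨f1, f2⟩ := State.f_mem hA hL
  have hcorner := fun τ hτ => not_corner_end hA hγ (τ := τ) ht hτ hst hL
  have hkey : ∀ X Y : ℝ, st.f θ = X * Real.sin θ - Y * Real.cos θ → st.U < X →
      ∃ τ, 0 < τ ∧ st.U + τ * Real.cos θ = X ∧ st.V + τ * Real.sin θ = Y := by
    intro X Y e hX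
    refine ⟨(X - st.U) / Real.cos θ, div_pos (by linarith) hc, ?_, ?_⟩
    · rw [div_mul_cancel₀ _ hc.ne']; ring
    · simp only [State.f] at e
      field_simp
      linarith
  have hlt : ∀ X Y : ℝ, st.f θ = X * Real.sin θ - Y * Real.cos θ → st.V < Y → st.U < X := by
    intro X Y e hY
    have : st.V * Real.cos θ < Y * Real.cos θ := by gcongr
    simp only [State.f] at e
    exact lt_of_mul_lt_mul_right (by linarith) hs.le
  have n1 : st.f θ ≠ (1 - a) * Real.sin θ - (1 - b) * Real.cos θ := by
    intro e
    obtain ⟨τ, hτ, h1, h2⟩ := hkey (1 - a) (1 - b) e (hL.or.elim id (hlt _ _ e))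
    exact hcorner τ hτ (Or.inl ⟨h1, h2⟩)
  have n2 : st.f θ ≠ 1 * Real.sin θ - (1 - b) * Real.cos θ := by
    intro e
    obtain ⟨τ, hτ, h1, h2⟩ := hkey 1 (1 - b) e hL.U_lt
    exact hcorner τ hτ (Or.inr (Or.inl ⟨h1, h2⟩))
  have n3 : st.f θ ≠ (1 - a) * Real.sin θ - 1 * Real.cos θ := by
    intro e
    obtain ⟨τ, hτ, h1, h2⟩ := hkey (1 - a) 1 e (hlt _ _ e hL.V_lt)
    exact hcorner τ hτ (Or.inr (Or.inr ⟨h1, h2⟩))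
  rcases lt_or_gt_of_ne n3 with h | h
  · exact ⟨v₁, by constructor <;> simp only [quadOf] <;> linarith⟩
  rcases lt_or_gt_of_ne n1 with h' | h'
  · exact ⟨h₂, by constructor <;> simp only [quadOf] <;> linarith⟩
  rcases lt_or_gt_of_ne n2 with h'' | h''
  · exact ⟨v₂, by constructor <;> simp only [quadOf] <;> linarith⟩
  · exact ⟨h₁, by constructor <;> simp only [quadOf] <;> linarith⟩

lemma Describes.flight (hA : Admissible a b θ) (hγ : IsForwardTrajectory a b θ γ) {t : ℝ}
    (ht : 0 ≤ t) {st : State} (hst : Describes a b γ t st) (hL : InL a b st.U st.V) {l : Letter}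
    (hf : st.f θ ∈ dom (quadOf a b θ) l) :
    Describes a b γ (t + flightTime a b θ st l) (nextState a b θ st l) ∧
      ∀ r, 0 ≤ r → r < flightTime a b θ st l →
        γ (t + r) = (point a b st.g (st.U + r * Real.cos θ) (st.V + r * Real.sin θ), st.g.dir) := by
  have hτ := flightTime_pos hA hL hf
  have hex := exitAt_flightTime hA hL hf
  obtain ⟨h1, h2, h3⟩ := hex.le hA
  have hfree := hst.free hA hL h1 h2 h3
  constructor
  · have hend := hγ.flight_end ht hτ hfree
    rw [hst] at hend
    simp only [← point_add] at hend
    rw [Describes, hend, (hex.point_eq hA).2, (hex.point_eq hA).1]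
  · intro r hr hr'
    rw [hγ.flight ht hfree r hr hr', hst]
    simp only [← point_add]

/-- A trajectory follows the sequence of states which starts at its initial state. -/
lemma Describes.regular (hA : Admissible a b θ) (hγ : IsForwardTrajectory a b θ γ) {st₀ : State}
    (hst : Describes a b γ 0 st₀) (hL : InL a b st₀.U st₀.V) : Regular a b θ st₀ ∧
      ∀ n, Describes a b γ (timeSeq a b θ st₀ n) (stateSeq a b θ st₀ n) := by
  have key : ∀ n, (0 ≤ timeSeq a b θ st₀ n ∧
      InL a b (stateSeq a b θ st₀ n).U (stateSeq a b θ st₀ n).V ∧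
      Describes a b γ (timeSeq a b θ st₀ n) (stateSeq a b θ st₀ n)) ∧
      (stateSeq a b θ st₀ n).f θ ∈ dom (quadOf a b θ) (letterSeq a b θ st₀ n) := by
    intro n
    induction n with
    | zero =>
      exact ⟨⟨le_rfl, hL, hst⟩, mem_dom_letterOf (exists_mem_dom hA hγ le_rfl hst hL)⟩
    | succ n ih =>
      obtain ⟨⟨h1, h2, h3⟩, h4⟩ := ih
      have h5 := flightTime_pos hA h2 h4
      have h6 : 0 ≤ timeSeq a b θ st₀ (n + 1) := by rw [timeSeq_succ]; linarith
      have h7 := (h3.flight hA hγ h1 h2 h4).1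
      have h8 := inL_nextState hA h2 h4
      exact ⟨⟨h6, h8, h7⟩, mem_dom_letterOf (exists_mem_dom hA hγ h6 h7 h8)⟩
  exact ⟨fun n => (key n).2, fun n => (key n).1.2.2⟩

/-- Every trajectory starts at some state. -/
lemma exists_describes (hA : Admissible a b θ) (hγ : IsForwardTrajectory a b θ γ) :
    ∃ st₀ : State, Describes a b γ 0 st₀ ∧ InL a b st₀.U st₀.V := by
  obtain ⟨i, U, hU, hU0, hU1⟩ := exists_coord a ((γ 0).1 0) (γ 0).2.1
  obtain ⟨j, V, hV, hV0, hV1⟩ := exists_coord b ((γ 0).1 1) (γ 0).2.2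
  have hst : Describes a b γ 0 ⟨⟨i, j, (γ 0).2.1, (γ 0).2.2⟩, U, V⟩ := by
    refine Prod.ext ?_ rfl
    ext k
    fin_cases k
    · exact hU
    · exact hV
  refine ⟨_, hst, hU0, hU1, hV0, hV1, ?_⟩
  -- A point with both coordinates beyond the crossing would enter the open scatterer at once.
  by_contra! hcon
  obtain ⟨h1, h2⟩ := hcon
  simp only at h1 h2
  obtain ⟨ε, hε, h⟩ := hγ.after 0 le_rfl
  have hc := hA.cos_pos
  have hs := hA.sin_pos
  obtain ⟨r, hr0, hr⟩ : ∃ r, 0 < r ∧ r < ε ∧ r < 1 - U ∧ r < 1 - V := by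
    obtain ⟨r, hr0, hr⟩ := exists_between (show 0 < min ε (min (1 - U) (1 - V)) from
      lt_min hε (lt_min (by linarith) (by linarith)))
    simp only [lt_min_iff] at hr
    exact ⟨r, hr0, hr⟩
  have := hγ.mem_table r hr0.le
  rw [h r hr0.le (by linarith), hst] at this
  simp only [sub_zero, ← point_add] at this
  have c1 : r * Real.cos θ ≤ r * 1 := by gcongr; exact Real.cos_le_one θ
  have s1 : r * Real.sin θ ≤ r * 1 := by gcongr; exact Real.sin_le_one θ
  have c2 : 0 < r * Real.cos θ := by positivity
  have s2 : 0 < r * Real.sin θ := by positivity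
  exact point_notMem_table (by linarith) (by linarith) (by linarith) (by linarith) this

end Trajectory

/-! ### Different flights do not meet -/

section Revisit

variable {a b θ : ℝ} {st₀ st : State} {l : Letter}

lemma inL_during (hA : Admissible a b θ) (hL : InL a b st.U st.V)
    (hf : st.f θ ∈ dom (quadOf a b θ) l) {r : ℝ} (hr : 0 ≤ r) (hr' : r < flightTime a b θ st l) :
    InL a b (st.U + r * Real.cos θ) (st.V + r * Real.sin θ) := by
  rcases hr.eq_or_lt with rfl | hr
  · simpa using hL
  · obtain ⟨h1, h2, h3⟩ := (exitAt_flightTime hA hL hf).le hA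
    exact (inL_flight hA hL h1 h2 h3 hr hr').1

lemma letter_of_U_gt (hA : Admissible a b θ) (hL : InL a b st.U st.V)
    (hf : st.f θ ∈ dom (quadOf a b θ) l) {r : ℝ} (hr' : r < flightTime a b θ st l)
    (h : 1 - a < st.U + r * Real.cos θ) : l = h₁ ∨ l = v₂ := by
  have hex := exitAt_flightTime hA hL hf
  have : r * Real.cos θ < flightTime a b θ st l * Real.cos θ := by
    have := hA.cos_pos; gcongr
  cases l <;> obtain ⟨h1, h2, h3⟩ := hex <;> first | (simp; done) | (exfalso; linarith)

lemma letter_of_V_gt (hA : Admissible a b θ) (hL : InL a b st.U st.V)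
    (hf : st.f θ ∈ dom (quadOf a b θ) l) {r : ℝ} (hr' : r < flightTime a b θ st l)
    (h : 1 - b < st.V + r * Real.sin θ) : l = v₁ ∨ l = h₂ := by
  have hex := exitAt_flightTime hA hL hf
  have : r * Real.sin θ < flightTime a b θ st l * Real.sin θ := by
    have := hA.sin_pos; gcongr
  cases l <;> obtain ⟨h1, h2, h3⟩ := hex <;> first | (simp; done) | (exfalso; linarith)

/-- A state in a crossing of corridors is reached by a passage. -/
lemma box_of_nextState (hA : Admissible a b θ) (hL : InL a b st.U st.V)
    (hf : st.f θ ∈ dom (quadOf a b θ) l) (hU : (nextState a b θ st l).U ≤ 1 - a)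
    (hV : (nextState a b θ st l).V ≤ 1 - b) :
    Box doubleParams l st.g.double (2 * (nextState a b θ st l).g.x)
      (2 * (nextState a b θ st l).g.y) := by
  have hex := exitAt_flightTime hA hL hf
  cases l <;> obtain ⟨h1, h2, h3⟩ := hex <;> simp only [nextState] at hU hV
  · rcases Int.units_eq_one_or st.g.ε with e | e <;>
      simp [nextState, act, unitParams, Box, Frame.double, doubleParams, mul_add, e]
  · linarith
  · rcases Int.units_eq_one_or st.g.δ with e | e <;>
      simp [nextState, act, unitParams, Box, Frame.double, doubleParams, mul_add, e]
  · linarith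

lemma Regular.U_le (hA : Admissible a b θ) (hL : InL a b st₀.U st₀.V) (hR : Regular a b θ st₀)
    {n m : ℕ} (hnm : n + 1 ≤ m) (h : ∀ k, n ≤ k → k < m → letterSeq a b θ st₀ k = v₂) :
    (stateSeq a b θ st₀ n).U + flightTime a b θ (stateSeq a b θ st₀ n) (letterSeq a b θ st₀ n) *
      Real.cos θ ≤ (stateSeq a b θ st₀ m).U := by
  induction m, hnm using Nat.le_induction with
  | base => rw [stateSeq_succ, h n le_rfl (by omega)]; simp [nextState]
  | succ m hm ih =>
    refine (ih fun k hk hk' => h k hk (by omega)).trans ?_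
    have h1 := flightTime_pos hA (hR.inL hA hL m) (hR m)
    rw [h m (by omega) (by omega)] at h1
    rw [stateSeq_succ, h m (by omega) (by omega)]
    simp only [nextState]
    have := mul_pos h1 hA.cos_pos
    linarith

lemma Regular.V_le (hA : Admissible a b θ) (hL : InL a b st₀.U st₀.V) (hR : Regular a b θ st₀)
    {n m : ℕ} (hnm : n + 1 ≤ m) (h : ∀ k, n ≤ k → k < m → letterSeq a b θ st₀ k = h₂) :
    (stateSeq a b θ st₀ n).V + flightTime a b θ (stateSeq a b θ st₀ n) (letterSeq a b θ st₀ n) *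
      Real.sin θ ≤ (stateSeq a b θ st₀ m).V := by
  induction m, hnm using Nat.le_induction with
  | base => rw [stateSeq_succ, h n le_rfl (by omega)]; simp [nextState]
  | succ m hm ih =>
    refine (ih fun k hk hk' => h k hk (by omega)).trans ?_
    have h1 := flightTime_pos hA (hR.inL hA hL m) (hR m)
    rw [h m (by omega) (by omega)] at h1
    rw [stateSeq_succ, h m (by omega) (by omega)]
    simp only [nextState]
    have := mul_pos h1 hA.sin_pos
    linarith

/-- Points of different flights are different. -/
lemma Regular.point_ne (hA : Admissible a b θ) (hZ : Renorm (quadOf a b θ))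
    (hL : InL a b st₀.U st₀.V) (hR : Regular a b θ st₀) {n m : ℕ} (hnm : n < m) {r r' : ℝ}
    (hr : 0 ≤ r)
    (hrτ : r < flightTime a b θ (stateSeq a b θ st₀ n) (letterSeq a b θ st₀ n))
    (hr' : 0 ≤ r')
    (hrτ' : r' < flightTime a b θ (stateSeq a b θ st₀ m) (letterSeq a b θ st₀ m)) :
    point a b (stateSeq a b θ st₀ n).g ((stateSeq a b θ st₀ n).U + r * Real.cos θ)
        ((stateSeq a b θ st₀ n).V + r * Real.sin θ) ≠
      point a b (stateSeq a b θ st₀ m).g ((stateSeq a b θ st₀ m).U + r' * Real.cos θ)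
        ((stateSeq a b θ st₀ m).V + r' * Real.sin θ) := by
  intro e
  have hc := hA.cos_pos
  have hs := hA.sin_pos
  have hO := hR.isOrbit hA
  have hd := hO.boxesDisjoint hZ
  have Ln := hR.inL hA hL n
  have Lm := hR.inL hA hL m
  have Dn := inL_during hA Ln (hR n) hr hrτ
  have Dm := inL_during hA Lm (hR m) hr' hrτ'
  have e0 : coord a _ _ _ = coord a _ _ _ := congrArg (fun p : Plane => p 0) e
  have e1 : coord b _ _ _ = coord b _ _ _ := congrArg (fun p : Plane => p 1) e
  have c0 := cellIndex_congr hA.a_pos hA.a_lt Dn.U_nonneg Dn.U_lt Dm.U_nonneg Dm.U_lt e0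
  have c1 := cellIndex_congr hA.b_pos hA.b_lt Dn.V_nonneg Dn.V_lt Dm.V_nonneg Dm.V_lt e1
  have i0 := cellIndex_even_iff c0
  have i1 := cellIndex_even_iff c1
  have rc : r * Real.cos θ < flightTime a b θ (stateSeq a b θ st₀ n) (letterSeq a b θ st₀ n) *
      Real.cos θ := by gcongr
  have rs : r * Real.sin θ < flightTime a b θ (stateSeq a b θ st₀ n) (letterSeq a b θ st₀ n) *
      Real.sin θ := by gcongr
  have rc0 : 0 ≤ r * Real.cos θ := by positivity
  have rs0 : 0 ≤ r * Real.sin θ := by positivity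
  have rc' : 0 ≤ r' * Real.cos θ := by positivity
  have rs' : 0 ≤ r' * Real.sin θ := by positivity
  -- In a horizontal passage both times belong to a single visit, consisting of `v₂` reflections up
  -- to the exit; `U` increases along it in a fixed frame, so the points differ.
  by_cases hB : 1 - a < (stateSeq a b θ st₀ n).U + r * Real.cos θ
  · have hV : ¬ 1 - b < (stateSeq a b θ st₀ n).V + r * Real.sin θ :=
      (Dn.or.resolve_left hB.not_gt).not_gt
    have hB' := i0.1 hB
    have hV' := fun h => hV (i1.2 h)
    simp only [cellIndex, if_pos hB, if_pos hB'] at c0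
    simp only [cellIndex, if_neg hV, if_neg hV'] at c1
    have hv := hO.eq_v₂_of_passage hZ.pos hd (letter_of_U_gt hA Ln (hR n) hrτ hB)
      (letter_of_U_gt hA Lm (hR m) hrτ' hB') c0 (by omega)
    obtain ⟨x1, x2, x3⟩ := hO.frame_of_v₂ hnm.le hv
    have hU := hR.U_le hA hL hnm hv
    rw [x1, x3] at e0
    have := coord_injective _ _ _ e0
    linarith
  · by_cases hC : 1 - b < (stateSeq a b θ st₀ n).V + r * Real.sin θ
    · have hB' := fun h => hB (i0.2 h)
      have hC' := i1.1 hC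
      simp only [cellIndex, if_neg hB, if_neg hB'] at c0
      simp only [cellIndex, if_pos hC, if_pos hC'] at c1
      have hl := letter_of_V_gt hA Ln (hR n) hrτ hC
      have hl' := letter_of_V_gt hA Lm (hR m) hrτ' hC'
      have hv := hO.swap.eq_v₂_of_passage hZ.pos.swap hd.swap (n := n) (m := m)
        (by rcases hl with h | h <;> simp [h, Letter.swap])
        (by rcases hl' with h | h <;> simp [h, Letter.swap]) c1
        (show (stateSeq a b θ st₀ n).g.x = (stateSeq a b θ st₀ m).g.x by omega)
      obtain ⟨x1, x2, x3⟩ := hO.swap.frame_of_v₂ hnm.le hv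
      have hV := hR.V_le hA hL hnm fun k hk hk' => by
        have := hv k hk hk'
        rcases h : letterSeq a b θ st₀ k <;> simp_all [Letter.swap]
      simp only [Frame.swap] at x1 x3
      rw [x1, x3] at e1
      have := coord_injective _ _ _ e1
      linarith
    · have hB' := fun h => hB (i0.2 h)
      have hC' := fun h => hC (i1.2 h)
      simp only [cellIndex, if_neg hB, if_neg hB'] at c0
      simp only [cellIndex, if_neg hC, if_neg hC'] at c1
      rw [not_lt] at hB hC
      replace hB' := not_lt.1 hB'
      replace hC' := not_lt.1 hC'
      -- In a crossing, the flight ending at index `m` entered it, and its box contains the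
      -- crossing. The earlier visit provides another such box, unless it is the starting point.
      obtain ⟨m, rfl⟩ : ∃ k, m = k + 1 := ⟨m - 1, by omega⟩
      have bm := box_of_nextState hA (hR.inL hA hL m) (hR m)
        (by rw [← stateSeq_succ]; linarith) (by rw [← stateSeq_succ]; linarith)
      rw [← stateSeq_succ] at bm
      rcases n with _ | n
      · have h0 := hO.box_ne_start hZ
          (by
            have h1 : (stateSeq a b θ st₀ 0).V * Real.cos θ ≤ (1 - b) * Real.cos θ := by
              gcongr; linarith
            have h2 := mul_nonneg Ln.U_nonneg hs.le
            simp only [quadOf, State.f]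
            linarith)
          (by
            have h1 : (stateSeq a b θ st₀ 0).U * Real.sin θ ≤ (1 - a) * Real.sin θ := by
              gcongr; linarith
            have h2 := mul_nonneg Ln.V_nonneg hc.le
            simp only [quadOf, State.f]
            linarith) m
        refine h0 ?_
        convert bm using 1 <;> omega
      · have bn := box_of_nextState hA (hR.inL hA hL n) (hR n)
          (by rw [← stateSeq_succ]; linarith) (by rw [← stateSeq_succ]; linarith)
        rw [← stateSeq_succ] at bn
        refine hd n m _ _ (by omega) bn ?_
        convert bm using 1 <;> omega

end Revisit

/-! ### Self-avoidance and escape to infinity -/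

section SelfAvoiding

variable {a b θ : ℝ} {γ : ℝ → Plane × K}

/-- The position of a trajectory at a given time, in terms of the sequence of states. -/
lemma Describes.exists_point (hA : Admissible a b θ) (hγ : IsForwardTrajectory a b θ γ)
    {st₀ : State} (hst : Describes a b γ 0 st₀) (hL : InL a b st₀.U st₀.V) {t : ℝ} (ht : 0 ≤ t) :
    ∃ n r, timeSeq a b θ st₀ n ≤ t ∧ t < timeSeq a b θ st₀ (n + 1) ∧
      t = timeSeq a b θ st₀ n + r ∧ 0 ≤ r ∧
      r < flightTime a b θ (stateSeq a b θ st₀ n) (letterSeq a b θ st₀ n) ∧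
      (γ t).1 = point a b (stateSeq a b θ st₀ n).g
        ((stateSeq a b θ st₀ n).U + r * Real.cos θ)
        ((stateSeq a b θ st₀ n).V + r * Real.sin θ) := by
  obtain ⟨hR, hS⟩ := hst.regular hA hγ hL
  obtain ⟨n, h1, h2⟩ := hR.exists_index hA hL ht
  have h3 : t - timeSeq a b θ st₀ n <
      flightTime a b θ (stateSeq a b θ st₀ n) (letterSeq a b θ st₀ n) := by
    rw [timeSeq_succ] at h2; linarith
  have h0 : 0 ≤ timeSeq a b θ st₀ n :=
    (hR.timeSeq_strictMono hA hL).monotone (Nat.zero_le n)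
  have h4 := ((hS n).flight hA hγ h0 (hR.inL hA hL n) (hR n)).2 (t - timeSeq a b θ st₀ n)
    (by linarith) h3
  refine ⟨n, t - timeSeq a b θ st₀ n, h1, h2, by ring, by linarith, h3, ?_⟩
  rw [add_sub_cancel] at h4
  rw [h4]

theorem IsForwardTrajectory.selfAvoiding (hA : Admissible a b θ) (hZ : Renorm (quadOf a b θ))
    (hγ : IsForwardTrajectory a b θ γ) : SelfAvoiding γ := by
  obtain ⟨st₀, hst, hL⟩ := exists_describes hA hγ
  obtain ⟨hR, -⟩ := hst.regular hA hγ hL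
  intro t ht t' ht' e
  obtain ⟨n, r, -, -, h1, h2, h3, h4⟩ := hst.exists_point hA hγ hL ht
  obtain ⟨n', r', -, -, h1', h2', h3', h4'⟩ := hst.exists_point hA hγ hL ht'
  simp only [h4, h4'] at e
  rcases lt_trichotomy n n' with hlt | rfl | hlt
  · exact absurd e (hR.point_ne hA hZ hL hlt h2 h3 h2' h3')
  · have e0 : coord a _ _ _ = coord a _ _ _ := congrArg (fun p : Plane => p 0) e
    have e1 := add_left_cancel (coord_injective _ _ _ e0)
    rw [h1, h1', mul_right_cancel₀ hA.cos_pos.ne' e1]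
  · exact absurd e.symm (hR.point_ne hA hZ hL hlt h2' h3' h2 h3)

theorem IsForwardTrajectory.tendsto_dist (hA : Admissible a b θ) (hZ : Renorm (quadOf a b θ))
    (hγ : IsForwardTrajectory a b θ γ) (x : Plane) :
    Filter.Tendsto (fun t => dist x (γ t).1) Filter.atTop Filter.atTop := by
  obtain ⟨st₀, hst, hL⟩ := exists_describes hA hγ
  obtain ⟨hR, -⟩ := hst.regular hA hγ hL
  have hO := hR.isOrbit hA
  have hd := hO.boxesDisjoint hZ
  have h1 : Filter.Tendsto (fun n => ((stateSeq a b θ st₀ n).g.x, (stateSeq a b θ st₀ n).g.y))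
      Filter.atTop Filter.cofinite := by
    rw [← Nat.cofinite_eq_atTop]
    refine Filter.Tendsto.cofinite_of_finite_preimage_singleton fun p => ?_
    refine (hO.finite_visits hZ.pos hd p.1 p.2).subset fun n hn => ?_
    have hn' : _ = p := hn
    exact ⟨congrArg Prod.fst hn', congrArg Prod.snd hn'⟩
  rw [← Filter.cocompact_eq_cofinite] at h1
  have h2 := (tendsto_norm_cocompact_atTop (E := ℤ × ℤ)).comp h1
  rw [Filter.tendsto_atTop]
  intro C
  obtain ⟨N, hN⟩ := Filter.eventually_atTop.1 (h2.eventually_ge_atTop (C + ‖x‖ + 2))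
  filter_upwards [Filter.eventually_ge_atTop (timeSeq a b θ st₀ N),
    Filter.eventually_ge_atTop 0] with t ht ht0
  obtain ⟨n, r, ht1, ht2, h3, h4, h5, h6⟩ := hst.exists_point hA hγ hL ht0
  have hnN : N ≤ n := by
    by_contra! hlt
    have := (hR.timeSeq_strictMono hA hL).monotone (show n + 1 ≤ N by omega)
    linarith
  have h7 := hN n hnN
  have D := inL_during hA (hR.inL hA hL n) (hR n) h4 h5
  have b0 := abs_coord_sub_le hA.a_pos hA.a_lt D.U_nonneg D.U_lt (stateSeq a b θ st₀ n).g.x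
    (stateSeq a b θ st₀ n).g.ε
  have b1 := abs_coord_sub_le hA.b_pos hA.b_lt D.V_nonneg D.V_lt (stateSeq a b θ st₀ n).g.y
    (stateSeq a b θ st₀ n).g.δ
  have n0 : |(γ t).1 0| ≤ ‖(γ t).1‖ := PiLp.norm_apply_le (γ t).1 0
  have n1 : |(γ t).1 1| ≤ ‖(γ t).1‖ := PiLp.norm_apply_le (γ t).1 1
  rw [h6, point_zero, ← h6] at n0
  rw [h6, point_one, ← h6] at n1
  have m0 : ‖((stateSeq a b θ st₀ n).g.x, (stateSeq a b θ st₀ n).g.y)‖ ≤ ‖(γ t).1‖ + 2 := by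
    rw [Prod.norm_mk, Int.norm_eq_abs, Int.norm_eq_abs]
    refine max_le ?_ ?_
    · have := abs_sub_abs_le_abs_sub ((stateSeq a b θ st₀ n).g.x : ℝ)
        (coord a (stateSeq a b θ st₀ n).g.x (stateSeq a b θ st₀ n).g.ε
          ((stateSeq a b θ st₀ n).U + r * Real.cos θ))
      rw [abs_sub_comm] at b0
      linarith
    · have := abs_sub_abs_le_abs_sub ((stateSeq a b θ st₀ n).g.y : ℝ)
        (coord b (stateSeq a b θ st₀ n).g.y (stateSeq a b θ st₀ n).g.δ
          ((stateSeq a b θ st₀ n).V + r * Real.sin θ))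
      rw [abs_sub_comm] at b1
      linarith
  have m1 : ‖(γ t).1‖ ≤ dist x (γ t).1 + ‖x‖ := by
    have := norm_sub_norm_le (γ t).1 x
    rw [← dist_eq_norm, dist_comm] at this
    linarith
  simp only [Function.comp] at h7
  linarith

theorem IsForwardTrajectory.liminf_edist (hA : Admissible a b θ) (hZ : Renorm (quadOf a b θ))
    (hγ : IsForwardTrajectory a b θ γ) (x : Plane) :
    Filter.liminf (fun t : ℝ => edist x (γ t).1) Filter.atTop = ⊤ := by
  refine Filter.Tendsto.liminf_eq ?_
  simp only [edist_dist]
  exact ENNReal.tendsto_ofReal_atTop.comp (hγ.tendsto_dist hA hZ x)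

end SelfAvoiding

/-! ### Existence of trajectories -/

section Existence

variable {a b θ : ℝ} {st₀ : State}

/-- Shifts are integral combinations of the entries of `Z`, so genericity persists and no endpoint
of an interval is ever hit. -/
lemma regular_of_generic (hA : Admissible a b θ) (hL : InL a b st₀.U st₀.V)
    (hg : Generic (quadOf a b θ) (st₀.f θ)) : Regular a b θ st₀ := by
  have hdom : ∀ st : State, InL a b st.U st.V → Generic (quadOf a b θ) (st.f θ) →
      st.f θ ∈ dom (quadOf a b θ) (letterOf (quadOf a b θ) (st.f θ)) := by
    intro st hL hg
    obtain ⟨h1, h2⟩ := State.f_mem hA hL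
    refine mem_dom_letterOf (exists_dom hg ?_ ?_) <;> simp only [quadOf] <;> linarith
  have key : ∀ n, InL a b (stateSeq a b θ st₀ n).U (stateSeq a b θ st₀ n).V ∧
      Generic (quadOf a b θ) ((stateSeq a b θ st₀ n).f θ) := by
    intro n
    induction n with
    | zero => exact ⟨hL, hg⟩
    | succ n ih =>
      refine ⟨inL_nextState hA ih.1 (hdom _ ih.1 ih.2), ?_⟩
      rw [stateSeq_succ, f_nextState hA]
      exact generic_shift ih.2 _
  exact fun n => hdom _ (key n).1 (key n).2

open Classical in
/-- The index of the flight which takes place at time `t`. -/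
noncomputable def flightIndex (a b θ : ℝ) (st₀ : State) (t : ℝ) : ℕ :=
  if h : ∃ n, timeSeq a b θ st₀ n ≤ t ∧ t < timeSeq a b θ st₀ (n + 1) then h.choose else 0

/-- The trajectory built from the sequence of states. -/
noncomputable def trajectory (a b θ : ℝ) (st₀ : State) (t : ℝ) : Plane × K :=
  let n := flightIndex a b θ st₀ t
  let st := stateSeq a b θ st₀ n
  let r := t - timeSeq a b θ st₀ n
  (point a b st.g (st.U + r * Real.cos θ) (st.V + r * Real.sin θ), st.g.dir)

lemma Regular.trajectory_eq (hA : Admissible a b θ) (hL : InL a b st₀.U st₀.V)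
    (hR : Regular a b θ st₀) {n : ℕ} {t : ℝ} (h1 : timeSeq a b θ st₀ n ≤ t)
    (h2 : t < timeSeq a b θ st₀ (n + 1)) : trajectory a b θ st₀ t =
      (point a b (stateSeq a b θ st₀ n).g
        ((stateSeq a b θ st₀ n).U + (t - timeSeq a b θ st₀ n) * Real.cos θ)
        ((stateSeq a b θ st₀ n).V + (t - timeSeq a b θ st₀ n) * Real.sin θ),
        (stateSeq a b θ st₀ n).g.dir) := by
  have hex : ∃ n, timeSeq a b θ st₀ n ≤ t ∧ t < timeSeq a b θ st₀ (n + 1) := ⟨n, h1, h2⟩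
  have hn : flightIndex a b θ st₀ t = n := by
    rw [flightIndex, dif_pos hex]
    obtain ⟨h3, h4⟩ := hex.choose_spec
    have hm := hR.timeSeq_strictMono hA hL
    have h5 := hm.lt_iff_lt.1 (h1.trans_lt h4)
    have h6 := hm.lt_iff_lt.1 (h3.trans_lt h2)
    omega
  simp only [trajectory, hn]

lemma notMem_corners_nextState (hA : Admissible a b θ) {st : State} {l : Letter}
    (hL : InL a b st.U st.V) (hf : st.f θ ∈ dom (quadOf a b θ) l) :
    point a b (nextState a b θ st l).g (nextState a b θ st l).U (nextState a b θ st l).V ∉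
      corners a b := by
  have hex := exitAt_flightTime hA hL hf
  refine point_notMem_corners hA.a_lt hA.b_lt ?_
  cases l <;> obtain ⟨h1, h2, h3⟩ := hex <;> simp only [nextState]
  · exact Or.inr (Or.inl ⟨h2, h3⟩)
  · exact Or.inr (Or.inr (Or.inr ⟨h2, h3⟩))
  · exact Or.inl ⟨h2, h3⟩
  · exact Or.inr (Or.inr (Or.inl ⟨h2, h3⟩))

lemma Regular.isForwardTrajectory (hA : Admissible a b θ) (hL : InL a b st₀.U st₀.V)
    (hU : 0 < st₀.U) (hV : 0 < st₀.V) (hR : Regular a b θ st₀) :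
    IsForwardTrajectory a b θ (trajectory a b θ st₀) := by
  have hc := hA.cos_pos
  have hs := hA.sin_pos
  have hin : ∀ {t : ℝ} {n : ℕ}, timeSeq a b θ st₀ n ≤ t → t < timeSeq a b θ st₀ (n + 1) →
      InL a b ((stateSeq a b θ st₀ n).U + (t - timeSeq a b θ st₀ n) * Real.cos θ)
        ((stateSeq a b θ st₀ n).V + (t - timeSeq a b θ st₀ n) * Real.sin θ) := by
    intro t n h1 h2
    rw [timeSeq_succ] at h2
    exact inL_during hA (hR.inL hA hL n) (hR n) (by linarith) (by linarith)
  have hpos : ∀ {t : ℝ} {n : ℕ}, timeSeq a b θ st₀ n < t →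
      0 < (stateSeq a b θ st₀ n).U + (t - timeSeq a b θ st₀ n) * Real.cos θ ∧
      0 < (stateSeq a b θ st₀ n).V + (t - timeSeq a b θ st₀ n) * Real.sin θ := by
    intro t n h1
    have L := hR.inL hA hL n
    have := mul_pos (sub_pos.2 h1) hc
    have := mul_pos (sub_pos.2 h1) hs
    exact ⟨by linarith [L.U_nonneg], by linarith [L.V_nonneg]⟩
  refine ⟨fun t ht => ?_, fun t ht => ?_, fun t ht => ?_, fun t ht => ?_⟩
  · obtain ⟨n, h1, h2⟩ := hR.exists_index hA hL ht
    rw [hR.trajectory_eq hA hL h1 h2]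
    have D := hin h1 h2
    exact point_mem_table
      (D.or.imp (fun h => ⟨D.U_nonneg, h.le⟩) (fun h => ⟨D.V_nonneg, h.le⟩))
  · obtain ⟨n, h1, h2⟩ := hR.exists_index hA hL ht
    rw [hR.trajectory_eq hA hL h1 h2]
    have D := hin h1 h2
    have hnc : ∀ {U V : ℝ} {g : Frame}, InL a b U V → 0 < U → 0 < V →
        point a b g U V ∉ corners a b := fun D hU hV =>
      point_notMem_corners hA.a_lt hA.b_lt
        (D.or.elim (fun h => Or.inl ⟨hU, h⟩) (fun h => Or.inr (Or.inl ⟨hV, h⟩)))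
    rcases h1.eq_or_lt with rfl | h1
    · simp only [sub_self, zero_mul, add_zero]
      rcases n with _ | n
      · exact hnc hL hU hV
      · exact notMem_corners_nextState hA (hR.inL hA hL n) (hR n)
    · exact hnc D (hpos h1).1 (hpos h1).2
  · obtain ⟨n, h1, h2⟩ := hR.exists_index hA hL ht
    refine ⟨timeSeq a b θ st₀ (n + 1) - t, by linarith, fun s h3 h4 => ?_⟩
    rw [hR.trajectory_eq hA hL h1 h2, hR.trajectory_eq hA hL (h1.trans h3) (by linarith)]
    simp only [← point_add]
    congr 2 <;> ring
  · obtain ⟨n, h1, h2⟩ := hR.exists_index hA hL ht.le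
    rcases h1.eq_or_lt with rfl | h1
    · rcases n with _ | n
      · exact absurd ht (lt_irrefl _)
      have hlt := hR.timeSeq_lt hA hL n
      refine ⟨timeSeq a b θ st₀ (n + 1) - timeSeq a b θ st₀ n, by linarith,
        fun s h3 h4 h5 => ?_⟩
      rw [hR.trajectory_eq hA hL le_rfl h2, hR.trajectory_eq hA hL (by linarith) h5]
      simp only [sub_self, zero_mul, add_zero]
      have hex := exitAt_flightTime hA (hR.inL hA hL n) (hR n)
      obtain ⟨p1, p2⟩ := hex.point_eq hA
      rw [← stateSeq_succ] at p1 p2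
      rw [← p2, ← p1, ← mul_assoc, K.mul_self, one_mul]
      refine Prod.ext ?_ rfl
      simp only
      rw [← neg_sub s, neg_smul, sub_neg_eq_add, ← point_add]
      have e := timeSeq_succ (a := a) (b := b) (θ := θ) (st₀ := st₀) n
      rw [e]
      congr 1 <;> ring
    · refine ⟨t - timeSeq a b θ st₀ n, by linarith, fun s h3 h4 h5 => ?_⟩
      rw [hR.trajectory_eq hA hL h1.le h2, hR.trajectory_eq hA hL (by linarith) (h5.trans h2)]
      simp only
      rw [(hin h1.le h2).reflection_eq_one (hpos h1).1 (hpos h1).2, one_mul]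
      refine Prod.ext ?_ rfl
      simp only
      rw [← neg_sub s, neg_smul, sub_neg_eq_add, ← point_add]
      congr 1 <;> ring

lemma Regular.trajectory_zero (hA : Admissible a b θ) (hL : InL a b st₀.U st₀.V)
    (hR : Regular a b θ st₀) :
    trajectory a b θ st₀ 0 = (point a b st₀.g st₀.U st₀.V, st₀.g.dir) := by
  have h := hR.trajectory_eq hA hL (n := 0) le_rfl (hR.timeSeq_lt hA hL 0)
  simpa [timeSeq, stateSeq] using h

open MeasureTheory in
lemma ae_linearMap_notMem {C : Set ℝ} (hC : C.Countable) {A B : ℝ} (hAB : A ≠ 0 ∨ B ≠ 0) :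
    ∀ᵐ x : Plane, A * x 0 + B * x 1 ∉ C := by
  let L : Plane →ₗ[ℝ] ℝ :=
    { toFun := fun x => A * x 0 + B * x 1
      map_add' := fun x y => by simp; ring
      map_smul' := fun r x => by simp; ring }
  have hL : Function.Surjective L := by
    refine L.surjective fun h => ?_
    have h0 : L !₂[1, 0] = 0 := by rw [h]; rfl
    have h1 : L !₂[0, 1] = 0 := by rw [h]; rfl
    simp [L] at h0 h1
    exact hAB.elim (fun h => h h0) (fun h => h h1)
  exact (ae_comp_linearMap_mem_iff L volume volume hL hC.measurableSet.compl).2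
    (by simpa using hC.ae_notMem volume)

lemma isClosed_table (a b : ℝ) : IsClosed (table a b) := by
  have : table a b = ⋂ i : ℤ, ⋂ j : ℤ, {p : Plane | |p 0 - i| < a / 2 ∧ |p 1 - j| < b / 2}ᶜ := by
    ext p; simp [table]
  rw [this]
  refine isClosed_iInter fun i => isClosed_iInter fun j => ?_
  rw [isClosed_compl_iff]
  have h0 : Continuous fun p : Plane => |p 0 - i| := by fun_prop
  have h1 : Continuous fun p : Plane => |p 1 - j| := by fun_prop
  exact (isOpen_lt h0 continuous_const).inter (isOpen_lt h1 continuous_const)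

open MeasureTheory in
theorem ae_exists_trajectory (hA : Admissible a b θ) :
    ∀ᵐ x ∂(volume.restrict (table a b)),
      ∃ γ, IsForwardTrajectory a b θ γ ∧ γ 0 = (x, 1) := by
  have hcount : ∀ a : ℝ, {x | ∃ i : ℤ, x = coord a i 1 0 ∨ x = coord a i 1 (1 - a)}.Countable := by
    intro a
    have : {x | ∃ i : ℤ, x = coord a i 1 0 ∨ x = coord a i 1 (1 - a)} =
        ⋃ i : ℤ, {coord a i 1 0, coord a i 1 (1 - a)} := by
      ext x; simp
    rw [this]
    exact Set.countable_iUnion fun i => (Set.toFinite _).countable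
  have hcount' : {r | ∃ i j : ℤ, ¬ Generic (quadOf a b θ)
      (r - coord a i 1 0 * Real.sin θ + coord b j 1 0 * Real.cos θ)}.Countable := by
    have : {r | ∃ i j : ℤ, ¬ Generic (quadOf a b θ)
        (r - coord a i 1 0 * Real.sin θ + coord b j 1 0 * Real.cos θ)} =
        ⋃ i : ℤ, ⋃ j : ℤ,
          (fun r => r - coord a i 1 0 * Real.sin θ + coord b j 1 0 * Real.cos θ) ⁻¹'
            {f | ¬ Generic (quadOf a b θ) f} := by
      ext x; simp
    rw [this]
    refine Set.countable_iUnion fun i => Set.countable_iUnion fun j =>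
      (countable_not_generic _).preimage fun r r' h => ?_
    simpa using h
  -- Countably many lines are removed: those carrying the sides of the scatterers, and lines in
  -- direction `θ` on which the transverse coordinate is not generic.
  filter_upwards [ae_restrict_mem (isClosed_table a b).measurableSet,
    ae_restrict_of_ae (ae_linearMap_notMem (hcount a) (A := 1) (B := 0) (by simp)),
    ae_restrict_of_ae (ae_linearMap_notMem (hcount b) (A := 0) (B := 1) (by simp)),
    ae_restrict_of_ae (ae_linearMap_notMem hcount' (A := Real.sin θ) (B := -Real.cos θ)
      (Or.inl hA.sin_pos.ne'))] with x hx h1 h2 h3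
  simp only [one_mul, zero_mul, add_zero, zero_add, not_exists, not_or, not_not] at h1 h2 h3
  obtain ⟨i, U, hU, hU0, hU1⟩ := exists_coord a (x 0) 1
  obtain ⟨j, V, hV, hV0, hV1⟩ := exists_coord b (x 1) 1
  have hxp : x = point a b ⟨i, j, 1, 1⟩ U V := by
    ext k
    fin_cases k
    · exact hU
    · exact hV
  have nU0 : U ≠ 0 := fun h => (h1 i).1 (by rw [hU, h])
  have nU1 : U ≠ 1 - a := fun h => (h1 i).2 (by rw [hU, h])
  have nV0 : V ≠ 0 := fun h => (h2 j).1 (by rw [hV, h])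
  have nV1 : V ≠ 1 - b := fun h => (h2 j).2 (by rw [hV, h])
  have hL : InL a b U V := by
    refine ⟨hU0, hU1, hV0, hV1, ?_⟩
    by_contra! hcon
    rw [hxp] at hx
    exact point_notMem_table (lt_of_le_of_ne hcon.1 nU1.symm) hU1
      (lt_of_le_of_ne hcon.2 nV1.symm) hV1 hx
  have hg : Generic (quadOf a b θ) (State.f θ ⟨⟨i, j, 1, 1⟩, U, V⟩) := by
    have := h3 i j
    rw [hU, hV] at this
    convert this using 1
    simp [State.f, coord]
    ring
  have hR := regular_of_generic (st₀ := ⟨⟨i, j, 1, 1⟩, U, V⟩) hA hL hg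
  refine ⟨_, hR.isForwardTrajectory hA hL (lt_of_le_of_ne hU0 nU0.symm)
    (lt_of_le_of_ne hV0 nV0.symm), ?_⟩
  rw [hR.trajectory_zero hA hL, hxp]
  rfl

end Existence

end WindTree

theorem theorem2 (a b θ : ℝ) (ha : a ∈ Set.Ioo (0 : ℝ) 1) (hb : b ∈ Set.Ioo (0 : ℝ) 1)
    (hθ : θ ∈ Set.Ico (0 : ℝ) (Real.pi / 2))
    (hren : WindTree.FRenormalizable (WindTree.quadOf a b θ))
    (heven : ∀ k : ℕ, Even (WindTree.convN (WindTree.quadOf a b θ) k)) :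
    (∀ γ : ℝ → WindTree.Plane × WindTree.K,
      WindTree.IsForwardTrajectory a b θ γ → WindTree.SelfAvoiding γ) ∧
    WindTree.DivergentFlow a b θ := by
  have hZ : WindTree.Renorm (WindTree.quadOf a b θ) := ⟨hren, heven⟩
  have hA : WindTree.Admissible a b θ :=
    ⟨ha.1, ha.2, hb.1, hb.2,
      Real.cos_pos_of_mem_Ioo ⟨by linarith [hθ.1, Real.pi_pos], hθ.2⟩,
      -- Positivity of the entry `y₁ = (1 - a) sin θ` rules out `θ = 0`.
      (mul_pos_iff_of_pos_left (sub_pos.2 ha.2)).1 hZ.pos.2.2.1⟩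
  refine ⟨fun γ hγ => hγ.selfAvoiding hA hZ, ?_⟩
  filter_upwards [WindTree.ae_exists_trajectory hA] with x hx
  exact ⟨hx, fun γ hγ _ => hγ.liminf_edist hA hZ x⟩
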